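/- Consider the deterministic $\mathsf{LOCAL}$ model: the network is a finite simple undirected graph $G$ with $n$ nodes and maximum degree $\Delta\ge 2$. Every node has a unique identifier from $\{0,\dots,n^c-1\}$, where $c$ is a constant, and an arbitrary numbering of its incident edges; initially it knows its identifier, its degree, $n$, $\Delta$ and $\varepsilon$. In each synchronous round every node sends a message of arbitrary size to each neighbor, receives its neighbors' messages, and performs an arbitrary local computation. At the end every node outputs the colors of its incident edges, and the two endpoints of an edge must output the same color. Logarithms are to base $2$. For every constant $c$ there are a constant $C=C(c)>0$ and a deterministic distributed algorithm such that, for every such network and every real $\varepsilon>1/\log\Delta$, the algorithm computes a proper edge coloring of $G$ with the $\lfloor(2+\varepsilon)\Delta\rfloor$ colors $0,1,\dots,\lfloor(2+\varepsilon)\Delta\rfloor-1$ in at most $$C\cdot \log^2\Delta\cdot\max\{1,\varepsilon^{-1}\}\cdot\max\{1,\log\log\Delta\}\cdot\bigl(\max\{1,\log\log\log\Delta\}\bigr)^{1.71}\cdot\log n$$ rounds. For $\varepsilon\le 1$ and $\Delta\ge 16$ this bound is $O\bigl(\log^2\Delta\cdot\varepsilon^{-1}\cdot\log\log\Delta\cdot(\log\log\log\Delta)^{1.71}\cdot\log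 n\bigr)$; the constants depend only on $c$, not on $n$, $\Delta$ or $\varepsilon$. -/

import Mathlib

/-- A deterministic distributed algorithm for the `LOCAL` model whose output is a natural number
(a colour) for each incident edge of each node.  A node of degree `d` addresses its incident edges
through its ports `Fin d`.  Local computation and message sizes are unrestricted. -/
structure LocalAlgorithm where
  /-- local states of a node -/
  State : Type
  /-- messages -/
  Msg : Type
  /-- number of synchronous rounds, as a function of the number of nodes `n`, the maximum
  degree `Δ` and the parameter `ε` -/
  rounds : (n Δ : ℕ) → (ε : ℝ) → ℕ
  /-- initial state of a node, from `n`, `Δ`, `ε`, its own identifier and its own degree -/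
  init : (n Δ : ℕ) → (ε : ℝ) → (ident d : ℕ) → State
  /-- the message that a node of degree `d` sends through each of its ports -/
  send : (d : ℕ) → State → Fin d → Msg
  /-- new state of a node of degree `d`, from its old state and the messages received through
  its ports -/
  receive : (d : ℕ) → State → (Fin d → Msg) → State
  /-- the colours that a node of degree `d` finally outputs for the edges at its ports -/
  output : (d : ℕ) → State → Fin d → ℕ

namespace LocalAlgorithm

variable {V : Type} [Fintype V] (G : SimpleGraph V) [DecidableRel G.Adj]

/-- A port numbering: every node numbers its neighbours by `0, …, degree - 1`. -/
abbrev PortNumbering : Type :=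
  (v : V) → Fin (G.degree v) ≃ G.neighborSet v

variable {G}

/-- The state of node `v` after `t` rounds of `A` on `G`.  In each round a node `v` receives,
through its port `i` leading to the neighbour `w`, the message which `w` sends through its port
leading to `v`. -/
def stateAfter (A : LocalAlgorithm) (ident : V → ℕ) (port : PortNumbering G) (ε : ℝ) :
    ℕ → V → A.State
  | 0, v => A.init (Fintype.card V) G.maxDegree ε (ident v) (G.degree v)
  | t + 1, v =>
      A.receive (G.degree v) (stateAfter A ident port ε t v) fun i =>
        A.send (G.degree (port v i)) (stateAfter A ident port ε t (port v i))
          ((port (port v i)).symm ⟨v, SimpleGraph.Adj.symm (port v i).2⟩)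

/-- The colour that node `v` outputs for the edge at its port `i`, after all rounds. -/
def finalOutput (A : LocalAlgorithm) (ident : V → ℕ) (port : PortNumbering G) (ε : ℝ)
    (v : V) (i : Fin (G.degree v)) : ℕ :=
  A.output (G.degree v)
    (stateAfter A ident port ε (A.rounds (Fintype.card V) G.maxDegree ε) v) i

/-- The outputs form a proper edge colouring of `G` with the `k` colours `0, …, k - 1`: both
endpoints of each edge output the colour of that edge. -/
def ComputesEdgeColoring (A : LocalAlgorithm) (ident : V → ℕ) (port : PortNumbering G) (ε : ℝ)
    (k : ℕ) : Prop :=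
  ∃ κ : G.lineGraph.Coloring (Fin k), ∀ (v : V) (i : Fin (G.degree v)),
    A.finalOutput ident port ε v i =
      (κ ⟨s(v, (port v i : V)), (port v i).2⟩ : ℕ)

end LocalAlgorithm

/-
The line graph has degree at most `2Δ - 2` and is coloured with `D = 2Δ - 1` colours, by extending a
partial colouring again and again. Every uncoloured vertex has more free colours than uncoloured
neighbours. If it draws a free colour with probability `1/4` and stays idle otherwise, it ends up
idle or in conflict with expected cost at most `3/4 + 1/8 = 7/8`.

The random choice is derandomised by halving all lists `O(log D)` times. In each sweep the vertices
are processed class by class, and each keeps the half of its list that is cheaper in conditional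
expectation. Few classes suffice because they need not form a proper colouring: weight inside the
classes is ignored, and halving two adjacent lists multiplies the cost of their edge by at most
four. An average defect of order `1 / log D` therefore costs a factor `16/15` over all sweeps, and
every extension step colours at least `1/15` of the remaining vertices, so that `11 m + 1` steps are
enough for identifiers below `2 ^ m`.

The classes arise by bootstrapping. Colour reduction with Reed–Solomon codes (Linial, Kuhn) gives
`O(r ^ 4)` classes of average defect `O(1 / r)` with `r = O(log log D)`. That defect is small enough
for rounding the uniform distribution on `2 ^ r` colours in the same way, in `r` sweeps, and the
resulting `O(log D)` classes have average defect `O(1 / log D)`.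

A quantity can be computed in `t` rounds if it is determined by the `t`-round view, and the nodes of
`G` can collect the views of their incident edges in the line graph.
-/

open Finset
open scoped BigOperators

namespace LocalColoring

section Halving

variable {ι : Type*}

/-- `A'` is one half of `A`, or `A` has odd size and is kept. -/
def IsHalf (A' A : Finset ι) : Prop :=
  A' ⊆ A ∧ (2 * #A' = #A ∨ Odd #A ∧ A' = A)

theorem IsHalf.card_le {A' A : Finset ι} (h : IsHalf A' A) : #A ≤ 2 * #A' := by
  rcases h.2 with h | ⟨_, rfl⟩ <;> omega

theorem IsHalf.card_eq_two_pow {A' A : Finset ι} (h : IsHalf A' A) {i : ℕ} (hA : #A = 2 ^ i) :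
    #A' = 2 ^ (i - 1) := by
  rcases h.2 with h' | ⟨hodd, rfl⟩ <;> rcases i with _ | i
  · omega
  · rw [hA, pow_succ] at h'
    simpa using (by omega : #A' = 2 ^ i)
  · simpa using hA
  · rw [hA] at hodd
    exact absurd hodd (by simp [pow_succ])

theorem exists_isHalf_expect_le (A : Finset ι) (f : ι → ℝ) :
    ∃ A', IsHalf A' A ∧ 𝔼 c ∈ A', f c ≤ 𝔼 c ∈ A, f c := by
  classical
  rcases Nat.even_or_odd #A with ⟨m, hm⟩ | hodd
  · obtain ⟨B, hBA, hB⟩ := exists_subset_card_eq (s := A) (n := m) (by omega)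
    have hsum : ∑ c ∈ A \ B, f c + ∑ c ∈ B, f c = ∑ c ∈ A, f c := sum_sdiff hBA
    have hcard : #(A \ B) = m := by rw [card_sdiff_of_subset hBA]; omega
    have of_le (A' : Finset ι) (hA' : A' ⊆ A) (hm' : #A' = m)
        (h : 2 * ∑ c ∈ A', f c ≤ ∑ c ∈ A, f c) : IsHalf A' A ∧ 𝔼 c ∈ A', f c ≤ 𝔼 c ∈ A, f c := by
      refine ⟨⟨hA', .inl (by omega)⟩, ?_⟩
      have hA : (#A : ℝ) = 2 * m := by rw [hm]; push_cast; ring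
      rw [expect_eq_sum_div_card, expect_eq_sum_div_card, hm', hA, ← div_div]
      gcongr
      linarith
    rcases le_total (∑ c ∈ A \ B, f c) (∑ c ∈ B, f c) with h | h
    · exact ⟨A \ B, of_le _ sdiff_subset hcard (by linarith)⟩
    · exact ⟨B, of_le _ hBA hB (by linarith)⟩
  · exact ⟨A, ⟨Subset.rfl, .inr ⟨hodd, rfl⟩⟩, le_rfl⟩

/-- A half of `A` on which the average of `f` is at most its average on `A`. -/
noncomputable def half (f : ι → ℝ) (A : Finset ι) : Finset ι :=
  (exists_isHalf_expect_le A f).choose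

theorem isHalf_half (f : ι → ℝ) (A : Finset ι) : IsHalf (half f A) A :=
  (exists_isHalf_expect_le A f).choose_spec.1

theorem expect_half_le (f : ι → ℝ) (A : Finset ι) : 𝔼 c ∈ half f A, f c ≤ 𝔼 c ∈ A, f c :=
  (exists_isHalf_expect_le A f).choose_spec.2

variable [DecidableEq ι]

/-- The probability that independent uniform elements of `A` and `B` coincide, where a coincidence
at `c` is counted with weight `μ c`. -/
noncomputable def overlap (μ : ι → ℝ) (A B : Finset ι) : ℝ :=
  (∑ c ∈ A ∩ B, μ c) / (#A * #B)

theorem overlap_comm (μ : ι → ℝ) (A B : Finset ι) : overlap μ A B = overlap μ B A := by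
  simp only [overlap, inter_comm, mul_comm]

theorem overlap_nonneg {μ : ι → ℝ} (hμ : 0 ≤ μ) (A B : Finset ι) : 0 ≤ overlap μ A B :=
  div_nonneg (sum_nonneg fun c _ => hμ c) (by positivity)

theorem overlap_eq_expect (μ : ι → ℝ) (A B : Finset ι) :
    overlap μ A B = 𝔼 c ∈ A, if c ∈ B then μ c / #B else 0 := by
  rw [expect_eq_sum_div_card, ← sum_filter, filter_mem_eq_inter, ← sum_div, div_div, mul_comm,
    overlap]

theorem overlap_le_expect_div_card {μ : ι → ℝ} (hμ : 0 ≤ μ) (A B : Finset ι) :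
    overlap μ A B ≤ (𝔼 c ∈ B, μ c) / #A := by
  rw [overlap, expect_eq_sum_div_card, div_div, mul_comm]
  gcongr
  · exact fun c _ _ => hμ c
  · exact inter_subset_right

theorem IsHalf.overlap_le {μ : ι → ℝ} (hμ : 0 ≤ μ) {A A' B B' : Finset ι} (hA : IsHalf A' A)
    (hB : IsHalf B' B) : overlap μ A' B' ≤ 4 * overlap μ A B := by
  rcases A.eq_empty_or_nonempty with rfl | hA₀
  · simp [overlap, subset_empty.1 hA.1]
  rcases B.eq_empty_or_nonempty with rfl | hB₀
  · simp [overlap, subset_empty.1 hB.1]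
  have hA₂ : (#A : ℝ) / 2 ≤ #A' := by
    rw [div_le_iff₀' two_pos]; exact_mod_cast hA.card_le
  have hB₂ : (#B : ℝ) / 2 ≤ #B' := by
    rw [div_le_iff₀' two_pos]; exact_mod_cast hB.card_le
  have : (0 : ℝ) < #A := by exact_mod_cast hA₀.card_pos
  have : (0 : ℝ) < #B := by exact_mod_cast hB₀.card_pos
  calc overlap μ A' B' ≤ (∑ c ∈ A ∩ B, μ c) / ((#A / 2) * (#B / 2)) := by
        unfold overlap
        gcongr
        · exact sum_nonneg fun c _ => hμ c
        · exact fun c _ _ => hμ c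
        · exact hA.1
        · exact hB.1
    _ = 4 * overlap μ A B := by unfold overlap; ring

end Halving

section Cost

variable {V : Type*} (H : SimpleGraph V) [H.LocallyFinite]

theorem sum_neighborFinset_comm [Fintype V] {M : Type*} [AddCommMonoid M] (f : V → V → M) :
    ∑ v, ∑ u ∈ H.neighborFinset v, f v u = ∑ v, ∑ u ∈ H.neighborFinset v, f u v :=
  sum_comm' fun v u => by simp [H.adj_comm]

variable {H} in
/-- Only pairs with one end in `p` contribute, and each of them is met from both of its ends. -/
theorem sum_neighborFinset_eq_two_mul [Fintype V] {f : V → V → ℝ} (hf : ∀ v u, f v u = f u v)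
    (p : V → Prop) [DecidablePred p] (h₀ : ∀ v u, (p v ↔ p u) → f v u = 0) :
    ∑ v, ∑ u ∈ H.neighborFinset v, f v u =
      ∑ v, if p v then 2 * ∑ u ∈ H.neighborFinset v, f v u else 0 := by
  have hsplit v u : f v u = (if p v then f v u else 0) + (if p u then f u v else 0) := by
    by_cases hv : p v <;> by_cases hu : p u <;> simp [hv, hu, h₀, hf u v]
  calc ∑ v, ∑ u ∈ H.neighborFinset v, f v u
      = ∑ v, ∑ u ∈ H.neighborFinset v, (if p v then f v u else 0) +
          ∑ v, ∑ u ∈ H.neighborFinset v, (if p u then f u v else 0) := by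
        simp only [← sum_add_distrib, ← hsplit]
    _ = ∑ v, if p v then 2 * ∑ u ∈ H.neighborFinset v, f v u else 0 := by
        rw [← sum_neighborFinset_comm H fun v u => if p v then f v u else 0, ← sum_add_distrib]
        refine sum_congr rfl fun v _ => ?_
        split_ifs <;> simp [two_mul]

/-- Nonnegative symmetric edge weights. They are defined on all pairs of vertices, but only the
values on edges matter. -/
structure IsWeight (W : V → V → ℝ) : Prop where
  symm : ∀ v u, W v u = W u v
  nonneg : ∀ v u, 0 ≤ W v u

/-- The total weight of the edges from `v` to its own class under `κ`. -/
def monoWeight {α : Type*} [DecidableEq α] (W : V → V → ℝ) (κ : V → α) (v : V) : ℝ :=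
  ∑ u ∈ H.neighborFinset v with κ u = κ v, W v u

/-- The weights `W` restricted to the edges between different classes of `κ`. -/
def crossWeight {α : Type*} [DecidableEq α] (κ : V → α) (W : V → V → ℝ) (v u : V) : ℝ :=
  if κ u = κ v then 0 else W v u

variable {ι : Type*} [DecidableEq ι]

/-- The expected cost of the pair `v`, `u` when the ends choose colours uniformly from their lists:
a common choice of `c` costs `W v u * μ c`. -/
noncomputable def edgeCost (W : V → V → ℝ) (μ : ι → ℝ) (L : V → Finset ι) (v u : V) : ℝ :=
  W v u * overlap μ (L v) (L u)

theorem IsWeight.edgeCost {W : V → V → ℝ} (hW : IsWeight W) {μ : ι → ℝ} (hμ : 0 ≤ μ)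
    (L : V → Finset ι) : IsWeight (edgeCost W μ L) where
  symm v u := by simp only [LocalColoring.edgeCost, hW.symm v u, overlap_comm μ (L v)]
  nonneg v u := mul_nonneg (hW.nonneg v u) (overlap_nonneg hμ _ _)

/-- The expected total cost of independent uniform choices from the lists `L`, where in addition a
vertex pays `h c` for choosing `c`. Every edge is paid for by both of its ends. -/
noncomputable def cost [Fintype V] (W : V → V → ℝ) (μ h : ι → ℝ) (L : V → Finset ι) : ℝ :=
  ∑ v, (𝔼 c ∈ L v, h c + ∑ u ∈ H.neighborFinset v, edgeCost W μ L v u)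

theorem sum_edgeCost_le_cost [Fintype V] (W : V → V → ℝ) (μ : ι → ℝ) {h : ι → ℝ} (hh : 0 ≤ h)
    (L : V → Finset ι) :
    ∑ v, ∑ u ∈ H.neighborFinset v, edgeCost W μ L v u ≤ cost H W μ h L :=
  sum_le_sum fun _ _ => le_add_of_nonneg_left (expect_nonneg fun c _ => hh c)

theorem cost_eq_cost_crossWeight_add [Fintype V] {α : Type*} [DecidableEq α] (κ : V → α)
    (W : V → V → ℝ) (μ h : ι → ℝ) (L : V → Finset ι) :
    cost H W μ h L = cost H (crossWeight κ W) μ h L + ∑ v, monoWeight H (edgeCost W μ L) κ v := by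
  simp only [cost, monoWeight, ← sum_add_distrib, add_assoc, sum_filter]
  refine sum_congr rfl fun v _ => congrArg _ (sum_congr rfl fun u _ => ?_)
  by_cases h : κ u = κ v <;> simp [edgeCost, crossWeight, h]

/-- The part of the expected cost that `v` is responsible for when it chooses `c` and the other
vertices choose from their lists; the factor two accounts for the other end of each edge. -/
noncomputable def colorCost (W : V → V → ℝ) (μ h : ι → ℝ) (L : V → Finset ι) (v : V) (c : ι) : ℝ :=
  h c + 2 * ∑ u ∈ H.neighborFinset v, W v u * (if c ∈ L u then μ c / #(L u) else 0)

theorem expect_colorCost (W : V → V → ℝ) (μ h : ι → ℝ) (L : V → Finset ι) (v : V) (A : Finset ι) :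
    𝔼 c ∈ A, colorCost H W μ h L v c =
      𝔼 c ∈ A, h c + 2 * ∑ u ∈ H.neighborFinset v, W v u * overlap μ A (L u) := by
  simp only [colorCost, expect_add_distrib, overlap_eq_expect, mul_expect, ← expect_sum_comm,
    mul_sum]

variable {H} in
/-- The method of conditional expectations: vertices that do not interact may change their lists
simultaneously. -/
theorem cost_le_cost_of_expect_colorCost_le [Fintype V] {W : V → V → ℝ}
    (hW : ∀ v u, W v u = W u v) {μ h : ι → ℝ} {L L' : V → Finset ι} (p : V → Prop)
    (hp : ∀ v u, p v → p u → W v u = 0) (hL : ∀ v, ¬ p v → L' v = L v)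
    (hle : ∀ v, p v →
      𝔼 c ∈ L' v, colorCost H W μ h L v c ≤ 𝔼 c ∈ L v, colorCost H W μ h L v c) :
    cost H W μ h L' ≤ cost H W μ h L := by
  classical
  have hsum := sum_neighborFinset_eq_two_mul (H := H)
    (f := fun v u => edgeCost W μ L' v u - edgeCost W μ L v u)
    (fun v u => by simp only [edgeCost, hW v u, overlap_comm μ _ (L' u), overlap_comm μ _ (L u)]) p
    (fun v u hvu => by
      by_cases hv : p v
      · simp [edgeCost, hp v u hv (hvu.1 hv)]
      · simp [edgeCost, hL v hv, hL u (hvu.not.1 hv)])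
  have hdiff : cost H W μ h L' - cost H W μ h L = ∑ v, if p v then
      𝔼 c ∈ L' v, colorCost H W μ h L v c - 𝔼 c ∈ L v, colorCost H W μ h L v c else 0 := by
    simp only [cost, sum_add_distrib, sum_sub_distrib] at hsum ⊢
    rw [add_sub_add_comm, hsum, ← sum_sub_distrib, ← sum_add_distrib]
    refine sum_congr rfl fun v _ => ?_
    split_ifs with hv
    · rw [expect_colorCost, expect_colorCost, add_sub_add_comm, ← mul_sub, ← sum_sub_distrib,
        ← sum_sub_distrib]
      congr 2
      refine sum_congr rfl fun u _ => ?_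
      by_cases hu : p u
      · simp [edgeCost, hp v u hv hu]
      · simp only [edgeCost, hL u hu]
    · simp [hL v hv]
  have hneg : ∑ v, (if p v then
      𝔼 c ∈ L' v, colorCost H W μ h L v c - 𝔼 c ∈ L v, colorCost H W μ h L v c else 0) ≤ 0 :=
    sum_nonpos fun v _ => by
      split_ifs with hv
      exacts [sub_nonpos.2 (hle v hv), le_rfl]
  linarith

end Cost

section Rounding

variable {V : Type*} (H : SimpleGraph V) [H.LocallyFinite] {ι : Type*} [DecidableEq ι]

/-- The lists `L` after the classes `0, …, j - 1` of `κ` have halved their lists, one class after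
the other. A vertex takes only the edges to other classes into account. -/
noncomputable def sweep (W : V → V → ℝ) (μ h : ι → ℝ) (κ : V → ℕ) (L : V → Finset ι) :
    ℕ → V → Finset ι
  | 0, v => L v
  | j + 1, v =>
      if κ v = j then
        half (colorCost H (crossWeight κ W) μ h (sweep W μ h κ L j) v) (sweep W μ h κ L j v)
      else sweep W μ h κ L j v

variable {H} {W : V → V → ℝ} {μ h : ι → ℝ} {κ : V → ℕ} {L : V → Finset ι}

theorem sweep_eq_of_le {j : ℕ} {v : V} (hj : j ≤ κ v) : sweep H W μ h κ L j v = L v := by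
  induction j with
  | zero => rfl
  | succ j ih => rw [sweep, if_neg (by omega), ih (by omega)]

theorem isHalf_sweep {j : ℕ} {v : V} (hj : κ v < j) : IsHalf (sweep H W μ h κ L j v) (L v) := by
  induction j with
  | zero => omega
  | succ j ih =>
    rw [sweep]
    split_ifs with hv
    · rw [sweep_eq_of_le hv.ge]
      exact isHalf_half _ _
    · exact ih (by omega)

variable [Fintype V]

theorem cost_crossWeight_sweep_le (hW : IsWeight W) (j : ℕ) :
    cost H (crossWeight κ W) μ h (sweep H W μ h κ L j) ≤ cost H (crossWeight κ W) μ h L := by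
  induction j with
  | zero => rfl
  | succ j ih =>
    refine le_trans ?_ ih
    refine cost_le_cost_of_expect_colorCost_le
      (fun v u => by simp only [crossWeight, hW.symm v u, eq_comm (a := κ u)]) (fun v => κ v = j)
      (fun v u hv hu => by simp [crossWeight, hv, hu]) (fun v hv => by simp [sweep, hv])
      fun v hv => ?_
    rw [sweep, if_pos hv]
    exact expect_half_le _ _

theorem cost_sweep_le (hW : IsWeight W) (hμ : 0 ≤ μ) {K : ℕ} (hK : ∀ v, κ v < K) :
    cost H W μ h (sweep H W μ h κ L K) ≤
      cost H W μ h L + 3 * ∑ v, monoWeight H (edgeCost W μ L) κ v := by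
  have hmono : ∑ v, monoWeight H (edgeCost W μ (sweep H W μ h κ L K)) κ v ≤
      4 * ∑ v, monoWeight H (edgeCost W μ L) κ v := by
    simp only [monoWeight, mul_sum]
    gcongr with v _ u _
    rw [edgeCost, edgeCost, mul_left_comm]
    exact mul_le_mul_of_nonneg_left
      ((isHalf_sweep (hK v)).overlap_le hμ (isHalf_sweep (hK u))) (hW.nonneg v u)
  have hcross := cost_crossWeight_sweep_le (H := H) (μ := μ) (h := h) (κ := κ) (L := L) hW K
  rw [cost_eq_cost_crossWeight_add H κ W, cost_eq_cost_crossWeight_add H κ W]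
  linarith

variable (H) in
/-- The rule `cl`, which assigns classes to the vertices depending on edge weights, uses the classes
`0, …, K - 1` and leaves at most a `δ`-fraction of the weight inside the classes. -/
def IsAvgDefective (δ : ℝ) (K : ℕ) (cl : (V → V → ℝ) → V → ℕ) : Prop :=
  ∀ W, IsWeight W → (∀ v, cl W v < K) ∧
    ∑ v, monoWeight H W (cl W) v ≤ δ * ∑ v, ∑ u ∈ H.neighborFinset v, W v u

theorem IsAvgDefective.mono {δ δ' : ℝ} {K : ℕ} {cl : (V → V → ℝ) → V → ℕ}
    (hcl : IsAvgDefective H δ K cl) (hδ : δ ≤ δ') : IsAvgDefective H δ' K cl := fun W hW =>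
  ⟨(hcl W hW).1, (hcl W hW).2.trans <| mul_le_mul_of_nonneg_right hδ <|
    sum_nonneg fun _ _ => sum_nonneg fun _ _ => hW.nonneg _ _⟩

variable (H) in
/-- The lists `L` after `s` sweeps, each over the classes that `cl` assigns for the current edge
costs. -/
noncomputable def roundLists (cl : (V → V → ℝ) → V → ℕ) (K : ℕ) (W : V → V → ℝ) (μ h : ι → ℝ)
    (L : V → Finset ι) : ℕ → V → Finset ι
  | 0 => L
  | s + 1 => sweep H W μ h (cl (edgeCost W μ (roundLists cl K W μ h L s)))
      (roundLists cl K W μ h L s) K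

section

variable {δ : ℝ} {K : ℕ} {cl : (V → V → ℝ) → V → ℕ}

theorem isHalf_roundLists_succ (hcl : IsAvgDefective H δ K cl) (hW : IsWeight W) (hμ : 0 ≤ μ)
    (s : ℕ) (v : V) :
    IsHalf (roundLists H cl K W μ h L (s + 1) v) (roundLists H cl K W μ h L s v) :=
  isHalf_sweep ((hcl _ (hW.edgeCost hμ _)).1 v)

theorem roundLists_subset (hcl : IsAvgDefective H δ K cl) (hW : IsWeight W) (hμ : 0 ≤ μ)
    (s : ℕ) (v : V) : roundLists H cl K W μ h L s v ⊆ L v := by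
  induction s with
  | zero => rfl
  | succ s ih => exact (isHalf_roundLists_succ hcl hW hμ s v).1.trans ih

theorem card_roundLists (hcl : IsAvgDefective H δ K cl) (hW : IsWeight W) (hμ : 0 ≤ μ)
    {v : V} {i : ℕ} (hv : #(L v) = 2 ^ i) (s : ℕ) :
    #(roundLists H cl K W μ h L s v) = 2 ^ (i - s) := by
  induction s with
  | zero => exact hv
  | succ s ih => exact (isHalf_roundLists_succ hcl hW hμ s v).card_eq_two_pow ih

theorem cost_roundLists_le (hcl : IsAvgDefective H δ K cl) (hδ : 0 ≤ δ) (hW : IsWeight W)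
    (hμ : 0 ≤ μ) (hh : 0 ≤ h) (s : ℕ) :
    cost H W μ h (roundLists H cl K W μ h L s) ≤ (1 + 3 * δ) ^ s * cost H W μ h L := by
  induction s with
  | zero => simp [roundLists]
  | succ s ih =>
    set L' := roundLists H cl K W μ h L s
    have hclass := hcl _ (hW.edgeCost hμ L')
    calc cost H W μ h (roundLists H cl K W μ h L (s + 1))
        ≤ cost H W μ h L' + 3 * (δ * ∑ v, ∑ u ∈ H.neighborFinset v, edgeCost W μ L' v u) :=
          (cost_sweep_le hW hμ hclass.1).trans (by linarith [hclass.2])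
      _ ≤ cost H W μ h L' + 3 * (δ * cost H W μ h L') := by
          gcongr
          exact sum_edgeCost_le_cost H W μ hh L'
      _ = (1 + 3 * δ) * cost H W μ h L' := by ring
      _ ≤ (1 + 3 * δ) * ((1 + 3 * δ) ^ s * cost H W μ h L) := by gcongr
      _ = (1 + 3 * δ) ^ (s + 1) * cost H W μ h L := by ring

theorem cost_roundLists_le_of_div {s : ℕ} (hs : 0 < s)
    (hcl : IsAvgDefective H (1 / (48 * s)) K cl) (hW : IsWeight W) (hμ : 0 ≤ μ) (hh : 0 ≤ h) :
    cost H W μ h (roundLists H cl K W μ h L s) ≤ 16 / 15 * cost H W μ h L := by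
  refine (cost_roundLists_le hcl (by positivity) hW hμ hh s).trans ?_
  have hcost : 0 ≤ cost H W μ h L :=
    (sum_nonneg fun _ _ => sum_nonneg fun _ _ => (hW.edgeCost hμ L).nonneg _ _).trans
      (sum_edgeCost_le_cost H W μ hh L)
  gcongr
  calc (1 + 3 * (1 / (48 * s)) : ℝ) ^ s ≤ Real.exp (1 / (16 * s)) ^ s := by
        have hstep : (1 + 3 * (1 / (48 * s)) : ℝ) = 1 / (16 * s) + 1 := by field_simp; ring
        gcongr
        exact hstep.trans_le (Real.add_one_le_exp _)
    _ = Real.exp (1 / 16) := by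
        rw [← Real.exp_nat_mul]
        congr 1
        field_simp
    _ ≤ 1 / (1 - 1 / 16) := Real.exp_bound_div_one_sub_of_interval (by norm_num) (by norm_num)
    _ = 16 / 15 := by norm_num

end

end Rounding

section Code

/-- The `m`-th Reed–Solomon codeword over `ZMod q`: the values of the polynomial whose coefficients
are the base `q` digits of `m`. -/
def code (q m : ℕ) (a : ZMod q) : ZMod q := Nat.ofDigits a (Nat.digits q m)

theorem coeff_ofDigits_X {R : Type*} [CommSemiring R] (l : List ℕ) (i : ℕ) :
    (Nat.ofDigits (Polynomial.X : Polynomial R) l).coeff i = (l.getD i 0 : ℕ) := by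
  induction l generalizing i with
  | nil => simp [Nat.ofDigits]
  | cons b l ih => cases i <;> simp [Nat.ofDigits, Polynomial.coeff_natCast_ite, ih]

theorem eval_ofDigits_X {R : Type*} [CommSemiring R] (a : R) (l : List ℕ) :
    (Nat.ofDigits (Polynomial.X : Polynomial R) l).eval a = Nat.ofDigits a l := by
  induction l with
  | nil => simp [Nat.ofDigits]
  | cons b l ih => simp [Nat.ofDigits, ih]

theorem card_code_eq_le {q d m m' : ℕ} [Fact q.Prime] (hm : m < q ^ d) (hm' : m' < q ^ d)
    (hne : m ≠ m') : #{a | code q m a = code q m' a} ≤ d := by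
  have hq : 1 < q := (Fact.out : q.Prime).one_lt
  set p : ℕ → Polynomial (ZMod q) := fun m => Nat.ofDigits Polynomial.X (Nat.digits q m)
  have hcoeff m i : (p m).coeff i = (m / q ^ i : ℕ) := by
    rw [coeff_ofDigits_X, Nat.getD_digits _ _ hq, ZMod.natCast_mod]
  have hdeg {m} (hm : m < q ^ d) : (p m).degree < d :=
    (Polynomial.degree_lt_iff_coeff_zero _ _).2 fun i hi => by
      rw [hcoeff, Nat.div_eq_of_lt (hm.trans_le (Nat.pow_le_pow_right hq.le hi)), Nat.cast_zero]
  by_contra! hcard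
  have hp : p m = p m' := by
    refine Polynomial.eq_of_degree_sub_lt_of_eval_finset_eq {a | code q m a = code q m' a} ?_ ?_
    · exact ((Polynomial.degree_sub_le _ _).trans_lt (max_lt (hdeg hm) (hdeg hm'))).trans
        (by exact_mod_cast hcard)
    · intro a ha
      rw [eval_ofDigits_X, eval_ofDigits_X]
      exact (mem_filter.1 ha).2
  have hmod k : m % q ^ k = m' % q ^ k := by
    induction k with
    | zero => simp [Nat.mod_one]
    | succ k ih =>
      have hdigit : m / q ^ k % q = m' / q ^ k % q :=
        (ZMod.natCast_eq_natCast_iff' _ _ _).1 (by rw [← hcoeff, ← hcoeff, hp])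
      rw [Nat.mod_pow_succ, Nat.mod_pow_succ, ih, hdigit]
  exact hne (by simpa [Nat.mod_eq_of_lt, hm, hm'] using hmod d)

theorem exists_prime_gt_le (X : ℕ) : ∃ q, q.Prime ∧ X < q ∧ q ≤ 2 * (X + 1) := by
  obtain ⟨q, hq, hlt, hle⟩ := Nat.exists_prime_lt_and_le_two_mul (X + 1) X.succ_ne_zero
  exact ⟨q, hq, X.lt_succ_self.trans hlt, hle⟩

/-- A prime above `X`, at most `2 * (X + 1)` by Bertrand's postulate. -/
noncomputable def primeAbove (X : ℕ) : ℕ := (exists_prime_gt_le X).choose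

theorem prime_primeAbove (X : ℕ) : (primeAbove X).Prime := (exists_prime_gt_le X).choose_spec.1

theorem lt_primeAbove (X : ℕ) : X < primeAbove X := (exists_prime_gt_le X).choose_spec.2.1

theorem primeAbove_le (X : ℕ) : primeAbove X ≤ 2 * (X + 1) :=
  (exists_prime_gt_le X).choose_spec.2.2

end Code

section DefectiveColoring

variable {V : Type*} (H : SimpleGraph V) [H.LocallyFinite]

/-- The weight of the edges from `v` to vertices of other colours whose codewords coincide with that
of `v` at `a`. -/
noncomputable def agreement (q : ℕ) (W : V → V → ℝ) (κ : V → ℕ) (v : V) (a : ZMod q) : ℝ :=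
  ∑ u ∈ H.neighborFinset v with κ u ≠ κ v ∧ code q (κ u) a = code q (κ v) a, W v u

/-- The point at which the codeword of `v` agrees least with those of its neighbours. -/
noncomputable def defectPoint (q : ℕ) (W : V → V → ℝ) (κ : V → ℕ) (v : V) : ZMod q :=
  Classical.epsilon fun a => ∀ b, agreement H q W κ v a ≤ agreement H q W κ v b

/-- One step of Linial's colour reduction, in the weighted defective version of Kuhn: the new colour
of `v` consists of a point `a` and the value of the codeword of the old colour at `a`. -/
noncomputable def defectColor (q : ℕ) (W : V → V → ℝ) (κ : V → ℕ) (v : V) : ℕ :=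
  Nat.pair (defectPoint H q W κ v).val (code q (κ v) (defectPoint H q W κ v)).val

variable {H} {q : ℕ} {W : V → V → ℝ} {κ : V → ℕ}

theorem defectColor_lt [NeZero q] (v : V) : defectColor H q W κ v < q ^ 2 :=
  (Nat.pair_lt_max_add_one_sq _ _).trans_le <|
    Nat.pow_le_pow_left (max_lt (ZMod.val_lt _) (ZMod.val_lt _)) 2

theorem sum_agreement_le [Fact q.Prime] {d : ℕ} (hκ : ∀ v, κ v < q ^ d) (hW : ∀ v u, 0 ≤ W v u)
    (v : V) : ∑ a, agreement H q W κ v a ≤ d * ∑ u ∈ H.neighborFinset v, W v u := by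
  simp only [agreement, sum_filter]
  rw [sum_comm, mul_sum]
  refine sum_le_sum fun u _ => ?_
  rw [← sum_filter, sum_const, nsmul_eq_mul]
  refine mul_le_mul_of_nonneg_right (Nat.cast_le.2 ?_) (hW v u)
  by_cases hu : κ u = κ v
  · simp [hu]
  · simpa [hu] using card_code_eq_le (hκ u) (hκ v) hu

theorem agreement_defectPoint_le [Fact q.Prime] {d : ℕ} (hκ : ∀ v, κ v < q ^ d)
    (hW : ∀ v u, 0 ≤ W v u) (v : V) :
    agreement H q W κ v (defectPoint H q W κ v) ≤ d / q * ∑ u ∈ H.neighborFinset v, W v u := by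
  have hmin := Classical.epsilon_spec (Finite.exists_min (agreement H q W κ v))
  have hq : (0 : ℝ) < q := by exact_mod_cast (Fact.out : q.Prime).pos
  rw [div_mul_eq_mul_div, le_div_iff₀' hq]
  refine le_trans ?_ (sum_agreement_le hκ hW v)
  simpa [ZMod.card, defectPoint] using
    card_nsmul_le_sum univ (agreement H q W κ v) _ fun b _ => hmin b

theorem monoWeight_defectColor_le [Fact q.Prime] {d : ℕ} (hκ : ∀ v, κ v < q ^ d)
    (hW : ∀ v u, 0 ≤ W v u) (v : V) :
    monoWeight H W (defectColor H q W κ) v ≤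
      monoWeight H W κ v + d / q * ∑ u ∈ H.neighborFinset v, W v u := by
  refine le_trans ?_ (add_le_add_right (agreement_defectPoint_le hκ hW v) _)
  simp only [monoWeight, agreement, sum_filter]
  rw [← sum_add_distrib]
  refine sum_le_sum fun u _ => ?_
  split_ifs with hnew hold hagree hagree <;> try linarith [hW v u]
  obtain ⟨hpoint, hcode⟩ := Nat.pair_eq_pair.1 hnew
  refine absurd ⟨hold, ?_⟩ hagree
  rw [← ZMod.val_injective q hpoint]
  exact ZMod.val_injective q (hcode.trans (by rw [ZMod.val_injective q hpoint]))

theorem monoWeight_eq_zero (hκ : ∀ v u, H.Adj v u → κ u ≠ κ v) (W : V → V → ℝ) (v : V) :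
    monoWeight H W κ v = 0 :=
  sum_eq_zero fun u hu => by
    rw [mem_filter, SimpleGraph.mem_neighborFinset] at hu
    exact absurd hu.2 (hκ v u hu.1)

theorem monoWeight_one_lt_one_iff (κ : V → ℕ) (v : V) :
    monoWeight H 1 κ v < 1 ↔ ∀ u, H.Adj v u → κ u ≠ κ v := by
  simp only [monoWeight, Pi.one_apply, sum_const, nsmul_eq_mul, mul_one]
  rw [Nat.cast_lt_one, card_eq_zero, filter_eq_empty_iff]
  simp

theorem le_primeAbove_pow_clog (X M : ℕ) : M ≤ primeAbove X ^ Nat.clog 2 M :=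
  (Nat.le_pow_clog one_lt_two M).trans
    (Nat.pow_le_pow_left (prime_primeAbove X).two_le _)

instance (X : ℕ) : Fact (primeAbove X).Prime := ⟨prime_primeAbove X⟩

theorem defectColor_ne_of_adj {D M : ℕ} (hdeg : ∀ v, H.degree v < D) (hM : ∀ v, κ v < M)
    (hκ : ∀ v u, H.Adj v u → κ u ≠ κ v) (v u : V) (hvu : H.Adj v u) :
    defectColor H (primeAbove (D * Nat.clog 2 M)) 1 κ u ≠
      defectColor H (primeAbove (D * Nat.clog 2 M)) 1 κ v := by
  set q := primeAbove (D * Nat.clog 2 M)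
  refine (monoWeight_one_lt_one_iff _ v).1 ?_ u hvu
  refine (monoWeight_defectColor_le (W := 1)
    (fun v => (hM v).trans_le (le_primeAbove_pow_clog _ _)) (fun _ _ => zero_le_one) v).trans_lt ?_
  have hq : (0 : ℝ) < q := by exact_mod_cast (prime_primeAbove _).pos
  rw [monoWeight_eq_zero hκ, zero_add, div_mul_eq_mul_div, div_lt_one hq]
  have hlt : Nat.clog 2 M * H.degree v < q :=
    (Nat.mul_le_mul_left _ (hdeg v).le).trans_lt (by rw [mul_comm]; exact lt_primeAbove _)
  simpa using mod_cast hlt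

end DefectiveColoring

section ColorReduction

theorem pow_le_factorial_mul_two_pow (k l : ℕ) : l ^ k ≤ k.factorial * 2 ^ k * 2 ^ l := by
  calc l ^ k ≤ (l + k).descFactorial k :=
        (Nat.pow_le_pow_left (by omega) k).trans (Nat.pow_sub_le_descFactorial _ _)
    _ = k.factorial * (l + k).choose k := Nat.descFactorial_eq_factorial_mul_choose _ _
    _ ≤ k.factorial * 2 ^ (l + k) := Nat.mul_le_mul_left _ (Nat.choose_le_two_pow _ _)
    _ = k.factorial * 2 ^ k * 2 ^ l := by ring

theorem two_pow_clog_le {M : ℕ} (hM : 1 < M) : 2 ^ Nat.clog 2 M ≤ 2 * M := by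
  have hpred := Nat.pow_pred_clog_lt_self one_lt_two hM
  rw [← Nat.succ_pred_eq_of_pos (Nat.clog_pos one_lt_two hM), pow_succ, mul_comm]
  exact Nat.mul_le_mul_left 2 hpred.le

variable {V : Type*} (H : SimpleGraph V) [H.LocallyFinite]

/-- Linial's colour reduction: at most `m` steps, each of which turns a colouring with `M` colours
into one with roughly `(D * log M) ^ 2` colours, where `D` exceeds the degrees. -/
noncomputable def reduceColors (D : ℕ) : (m M : ℕ) → (V → ℕ) → V → ℕ
  | 0, _, κ => κ
  | m + 1, M, κ =>
      if M ≤ (32 * D) ^ 4 then κ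
      else
        let q := primeAbove (D * Nat.clog 2 M)
        reduceColors D m (q ^ 2) (defectColor H q 1 κ)

theorem two_mul_primeAbove_sq_le {D M : ℕ} (hD : 0 < D) (hM : (32 * D) ^ 4 < M) :
    2 * primeAbove (D * Nat.clog 2 M) ^ 2 ≤ M := by
  set l := Nat.clog 2 M
  have hM₁ : 1 < M := (Nat.one_le_pow _ _ (by omega)).trans_lt hM
  have hl : 0 < l := Nat.clog_pos one_lt_two hM₁
  have hl₄ : l ^ 4 ≤ 768 * M :=
    (pow_le_factorial_mul_two_pow 4 l).trans (by
      have : 2 ^ l ≤ 2 * M := two_pow_clog_le hM₁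
      simp only [Nat.factorial]
      omega)
  have hq : primeAbove (D * l) ≤ 4 * (D * l) :=
    (primeAbove_le _).trans (by have := Nat.mul_pos hD hl; omega)
  have hsq : (32 * (D * l) ^ 2) ^ 2 ≤ M ^ 2 := by
    calc (32 * (D * l) ^ 2) ^ 2 = 1024 * D ^ 4 * l ^ 4 := by ring
      _ ≤ 1024 * D ^ 4 * (768 * M) := by gcongr
      _ ≤ (32 * D) ^ 4 * M := by rw [mul_pow]; nlinarith [Nat.zero_le (D ^ 4 * M)]
      _ ≤ M ^ 2 := by rw [sq]; gcongr
  calc 2 * primeAbove (D * l) ^ 2 ≤ 2 * (4 * (D * l)) ^ 2 := by gcongr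
    _ = 32 * (D * l) ^ 2 := by ring
    _ ≤ M := (Nat.pow_le_pow_iff_left two_ne_zero).1 hsq

variable {H}

theorem reduceColors_spec {D : ℕ} (hD : 0 < D) (hdeg : ∀ v, H.degree v < D) {m M : ℕ} {κ : V → ℕ}
    (hMm : M ≤ 2 ^ m) (hM : ∀ v, κ v < M) (hκ : ∀ v u, H.Adj v u → κ u ≠ κ v) :
    (∀ v, reduceColors H D m M κ v < (32 * D) ^ 4) ∧
      ∀ v u, H.Adj v u → reduceColors H D m M κ u ≠ reduceColors H D m M κ v := by
  induction m generalizing M κ with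
  | zero =>
    refine ⟨fun v => (hM v).trans_le ?_, hκ⟩
    have := Nat.one_le_pow 4 (32 * D) (by omega)
    rw [pow_zero] at hMm
    omega
  | succ m ih =>
    rw [reduceColors]
    split_ifs with hsmall
    · exact ⟨fun v => (hM v).trans_le hsmall, hκ⟩
    refine ih ?_ defectColor_lt (defectColor_ne_of_adj hdeg hM hκ)
    have := two_mul_primeAbove_sq_le hD (not_le.1 hsmall)
    rw [pow_succ] at hMm
    omega

end ColorReduction

section Classes

variable {V : Type*} (H : SimpleGraph V) [H.LocallyFinite]

theorem isWeight_one : IsWeight (1 : V → V → ℝ) := ⟨fun _ _ => rfl, fun _ _ => zero_le_one⟩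

/-- The field size for which recolouring `M` colours leaves at most a fraction `1 / (96 * r)` of the
weight in new conflicts. -/
noncomputable def classPrime (r M : ℕ) : ℕ := primeAbove (96 * r * Nat.clog 2 M)

instance (r M : ℕ) : Fact (classPrime r M).Prime := ⟨prime_primeAbove _⟩

theorem clog_div_classPrime_le {r : ℕ} (hr : 0 < r) (M : ℕ) :
    (Nat.clog 2 M : ℝ) / classPrime r M ≤ 1 / (96 * r) := by
  have hlt : 96 * r * Nat.clog 2 M < classPrime r M := lt_primeAbove _
  have hpos : 0 < classPrime r M := (Nat.zero_le _).trans_lt hlt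
  rw [div_le_div_iff₀ (by positivity) (by positivity), one_mul, mul_comm]
  exact_mod_cast hlt.le

variable {H} in
theorem monoWeight_defectColor_classPrime_le {r : ℕ} (hr : 0 < r) {M : ℕ} {κ : V → ℕ}
    (hM : ∀ v, κ v < M) {W : V → V → ℝ} (hW : IsWeight W) (v : V) :
    monoWeight H W (defectColor H (classPrime r M) W κ) v ≤
      monoWeight H W κ v + 1 / (96 * r) * ∑ u ∈ H.neighborFinset v, W v u := by
  have hcode v : κ v < classPrime r M ^ Nat.clog 2 M :=
    (hM v).trans_le (le_primeAbove_pow_clog _ _)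
  refine (monoWeight_defectColor_le hcode hW.nonneg v).trans (add_le_add_right ?_ _)
  exact mul_le_mul_of_nonneg_right (clog_div_classPrime_le hr M)
    (sum_nonneg fun u _ => hW.nonneg v u)

/-- The number of classes of `fineClasses`. -/
noncomputable def fineClassCount (r M : ℕ) : ℕ := classPrime r (classPrime r M ^ 2) ^ 2

/-- Classes of average defect `1 / (48 * r)`, obtained from a proper colouring `κ` with `M` colours
in two recolouring steps. -/
noncomputable def fineClasses (r M : ℕ) (κ : V → ℕ) (W : V → V → ℝ) : V → ℕ :=
  defectColor H (classPrime r (classPrime r M ^ 2)) W (defectColor H (classPrime r M) W κ)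

/-- Classes obtained by rounding the uniform distribution on `2 ^ r` colours with the help of the
classes that `cl` provides. The lists are singletons after `r` sweeps. -/
noncomputable def roundedClasses (cl : (V → V → ℝ) → V → ℕ) (K r : ℕ) (W : V → V → ℝ) (v : V) : ℕ :=
  (roundLists H cl K W 1 0 (fun _ => range (2 ^ r)) r v).sup id

variable {H}

theorem monoWeight_fineClasses_le {r : ℕ} (hr : 0 < r) {M : ℕ} {κ : V → ℕ} (hM : ∀ v, κ v < M)
    (hκ : ∀ v u, H.Adj v u → κ u ≠ κ v) {W : V → V → ℝ} (hW : IsWeight W) (v : V) :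
    monoWeight H W (fineClasses H r M κ W) v ≤
      1 / (48 * r) * ∑ u ∈ H.neighborFinset v, W v u := by
  have hfirst := monoWeight_defectColor_classPrime_le (H := H) hr hM hW v
  have hsecond := monoWeight_defectColor_classPrime_le (H := H) hr
    (defectColor_lt (H := H) (q := classPrime r M) (W := W) (κ := κ)) hW v
  rw [monoWeight_eq_zero hκ] at hfirst
  have htwo : (1 : ℝ) / (48 * r) = 1 / (96 * r) + 1 / (96 * r) := by ring
  rw [fineClasses, htwo]
  linarith

variable [Fintype V]

theorem isAvgDefective_fineClasses {r : ℕ} (hr : 0 < r) {M : ℕ} {κ : V → ℕ} (hM : ∀ v, κ v < M)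
    (hκ : ∀ v u, H.Adj v u → κ u ≠ κ v) :
    IsAvgDefective H (1 / (48 * r)) (fineClassCount r M) (fineClasses H r M κ) := by
  refine fun W hW => ⟨fun v => defectColor_lt v, ?_⟩
  rw [mul_sum]
  exact sum_le_sum fun v _ => monoWeight_fineClasses_le hr hM hκ hW v

theorem cost_const_range (W : V → V → ℝ) (N : ℕ) :
    cost H W 1 0 (fun _ => range N) = 1 / N * ∑ v, ∑ u ∈ H.neighborFinset v, W v u := by
  simp [cost, edgeCost, overlap, mul_sum, mul_comm]

theorem isAvgDefective_roundedClasses {cl : (V → V → ℝ) → V → ℕ} {K r : ℕ} (hr : 0 < r)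
    (hcl : IsAvgDefective H (1 / (48 * r)) K cl) :
    IsAvgDefective H (16 / 15 / 2 ^ r) (2 ^ r) (roundedClasses H cl K r) := by
  intro W hW
  set L := roundLists H cl K W (1 : ℕ → ℝ) 0 (fun _ => range (2 ^ r)) r
  have hsingleton v : ∃ c < 2 ^ r, L v = {c} := by
    obtain ⟨c, hc⟩ : ∃ c, L v = {c} := card_eq_one.1 <| by
      have hcard : #(L v) = 2 ^ (r - r) :=
        card_roundLists hcl hW zero_le_one (card_range (2 ^ r)) r
      simpa using hcard
    have hsubset : L v ⊆ range (2 ^ r) := roundLists_subset hcl hW zero_le_one r v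
    exact ⟨c, mem_range.1 (hsubset (hc ▸ mem_singleton_self c)), hc⟩
  choose c hc hLc using hsingleton
  have hclass : roundedClasses H cl K r W = c := funext fun v => by
    change (L v).sup id = c v
    rw [hLc, sup_singleton, id]
  refine ⟨fun v => hclass ▸ hc v, ?_⟩
  calc ∑ v, monoWeight H W (roundedClasses H cl K r W) v ≤ cost H W 1 0 L := by
        rw [hclass]
        refine sum_le_sum fun v _ => ?_
        rw [monoWeight, sum_filter]
        refine (sum_le_sum fun u _ => ?_).trans (le_add_of_nonneg_left (by simp))
        split_ifs with h
        · simp [edgeCost, hLc, overlap, h]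
        · exact (hW.edgeCost zero_le_one L).nonneg v u
    _ ≤ 16 / 15 * cost H W 1 0 (fun _ => range (2 ^ r)) :=
        cost_roundLists_le_of_div hr hcl hW zero_le_one le_rfl
    _ = 16 / 15 / 2 ^ r * ∑ v, ∑ u ∈ H.neighborFinset v, W v u := by
        rw [cost_const_range]
        push_cast
        ring

end Classes

section Extension

/-- The weight of the colours below `D`. -/
noncomputable def realColor (D : ℕ) : ℕ → ℝ := (Set.Iio D).indicator 1

/-- The weight of the dummy colours, which are those from `D` on: a vertex that ends up with a dummy
colour stays uncoloured. -/
noncomputable def dummyColor (D : ℕ) : ℕ → ℝ := (Set.Ici D).indicator 1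

theorem realColor_nonneg (D : ℕ) : 0 ≤ realColor D :=
  fun _ => Set.indicator_nonneg (fun _ _ => zero_le_one) _

theorem dummyColor_nonneg (D : ℕ) : 0 ≤ dummyColor D :=
  fun _ => Set.indicator_nonneg (fun _ _ => zero_le_one) _

/-- The list `A` together with three dummy colours for each of its elements. -/
def pad (D : ℕ) (A : Finset ℕ) : Finset ℕ := A ∪ Ico D (D + 3 * #A)

section

variable {D : ℕ} {A : Finset ℕ} (hA : A ⊆ range D)
include hA

theorem disjoint_Ico_of_subset_range (N : ℕ) : Disjoint A (Ico D N) :=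
  disjoint_left.2 fun _ hc hc' => (mem_range.1 (hA hc)).not_ge (mem_Ico.1 hc').1

theorem card_pad : #(pad D A) = 4 * #A := by
  rw [pad, card_union_of_disjoint (disjoint_Ico_of_subset_range hA _), Nat.card_Ico]
  omega

theorem expect_realColor_pad (hA₀ : A.Nonempty) : 𝔼 c ∈ pad D A, realColor D c = 1 / 4 := by
  have hreal c (hc : c ∈ A) : realColor D c = 1 :=
    Set.indicator_of_mem (Set.mem_Iio.2 (mem_range.1 (hA hc))) 1
  have hdummy c (hc : c ∈ Ico D (D + 3 * #A)) : realColor D c = 0 :=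
    Set.indicator_of_notMem (Set.notMem_Iio.2 (mem_Ico.1 hc).1) 1
  have hsum : ∑ c ∈ pad D A, realColor D c = #A := by
    rw [pad, sum_union (disjoint_Ico_of_subset_range hA _), sum_congr rfl hreal,
      sum_eq_zero hdummy]
    simp
  have : (#A : ℝ) ≠ 0 := by exact_mod_cast hA₀.card_ne_zero
  rw [expect_eq_sum_div_card, hsum, card_pad hA]
  push_cast
  field_simp

theorem expect_dummyColor_pad (hA₀ : A.Nonempty) : 𝔼 c ∈ pad D A, dummyColor D c = 3 / 4 := by
  have hcompl c : dummyColor D c = 1 - realColor D c := by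
    by_cases hc : c < D <;> simp [dummyColor, realColor, Set.indicator, hc]
  have hpad : (pad D A).Nonempty := hA₀.mono subset_union_left
  simp only [hcompl, expect_sub_distrib, expect_const hpad, expect_realColor_pad hA hA₀]
  norm_num

end

theorem exists_subset_card_two_pow {ι : Type*} (A : Finset ι) :
    ∃ B ⊆ A, A.Nonempty → #B = 2 ^ Nat.log 2 #A := by
  rcases A.eq_empty_or_nonempty with rfl | hA
  · exact ⟨∅, Subset.rfl, by simp⟩
  · obtain ⟨B, hBA, hB⟩ := exists_subset_card_eq (Nat.pow_log_le_self 2 hA.card_ne_zero)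
    exact ⟨B, hBA, fun _ => hB⟩

/-- A subset whose size is the largest possible power of two (unless `A` is empty). -/
noncomputable def twoPowSubset {ι : Type*} (A : Finset ι) : Finset ι :=
  (exists_subset_card_two_pow A).choose

theorem twoPowSubset_subset {ι : Type*} (A : Finset ι) : twoPowSubset A ⊆ A :=
  (exists_subset_card_two_pow A).choose_spec.1

theorem card_twoPowSubset {ι : Type*} {A : Finset ι} (hA : A.Nonempty) :
    #(twoPowSubset A) = 2 ^ Nat.log 2 #A :=
  (exists_subset_card_two_pow A).choose_spec.2 hA

variable {V : Type*} (H : SimpleGraph V) [H.LocallyFinite]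

/-- The assignment `γ` of colours below `D` to some of the vertices is proper where it is
defined. -/
def IsPartialColoring (D : ℕ) (γ : V → Option ℕ) : Prop :=
  ∀ v c, γ v = some c → c < D ∧ ∀ u, H.Adj v u → γ u ≠ some c

/-- The colours below `D` that no neighbour of `v` has. -/
def freeColors (D : ℕ) (γ : V → Option ℕ) (v : V) : Finset ℕ :=
  {c ∈ range D | ∀ u ∈ H.neighborFinset v, γ u ≠ some c}

/-- The initial lists for the extension of `γ`: a free colour is chosen with probability `1 / 4`,
and no colour otherwise. The sizes are powers of two, so that the lists can be halved. -/
noncomputable def candidates (D : ℕ) (γ : V → Option ℕ) (v : V) : Finset ℕ :=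
  if γ v = none then pad D (twoPowSubset (freeColors H D γ v)) else ∅

/-- The vertices whose list consists of one colour below `D`, different from the lists of all
neighbours, get this colour. -/
def adopt (D : ℕ) (γ : V → Option ℕ) (L : V → Finset ℕ) (v : V) : Option ℕ :=
  if #(L v) = 1 ∧ L v ⊆ range D ∧ ∀ u ∈ H.neighborFinset v, L u ≠ L v then some ((L v).sup id)
  else γ v

/-- One extension step, which rounds the candidate lists and lets vertices adopt the results. -/
noncomputable def extendColoring (D : ℕ) (cl : (V → V → ℝ) → V → ℕ) (K s : ℕ)
    (γ : V → Option ℕ) : V → Option ℕ :=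
  adopt H D γ (roundLists H cl K 1 (realColor D) (dummyColor D) (candidates H D γ) s)

variable {H} {D : ℕ} {γ : V → Option ℕ} {L : V → Finset ℕ} {v : V}

theorem card_uncolored_neighbors_lt_card_freeColors (hdeg : H.degree v < D) :
    #{u ∈ H.neighborFinset v | γ u = none} < #(freeColors H D γ v) := by
  have hcover : range D ⊆ freeColors H D γ v ∪
      {u ∈ H.neighborFinset v | ¬γ u = none}.image fun u => (γ u).getD 0 := by
    intro c hc
    rw [mem_union, freeColors, mem_filter, mem_image]
    by_cases hfree : ∀ u ∈ H.neighborFinset v, γ u ≠ some c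
    · exact .inl ⟨hc, hfree⟩
    · push Not at hfree
      obtain ⟨u, hu, huc⟩ := hfree
      exact .inr ⟨u, by simp_all⟩
  have hD := (card_le_card hcover).trans (card_union_le _ _)
  have himage := card_image_le (s := {u ∈ H.neighborFinset v | ¬γ u = none})
    (f := fun u => (γ u).getD 0)
  have hsplit := card_filter_add_card_filter_not (s := H.neighborFinset v) (γ · = none)
  rw [card_range] at hD
  rw [SimpleGraph.card_neighborFinset_eq_degree] at hsplit
  omega

theorem freeColors_nonempty (hdeg : H.degree v < D) : (freeColors H D γ v).Nonempty :=
  card_pos.1 ((Nat.zero_le _).trans_lt (card_uncolored_neighbors_lt_card_freeColors hdeg))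

theorem twoPowSubset_freeColors_subset_range :
    twoPowSubset (freeColors H D γ v) ⊆ range D :=
  (twoPowSubset_subset _).trans (filter_subset _ _)

theorem card_candidates (hdeg : H.degree v < D) (hv : γ v = none) :
    #(candidates H D γ v) = 2 ^ (Nat.log 2 #(freeColors H D γ v) + 2) := by
  rw [candidates, if_pos hv, card_pad twoPowSubset_freeColors_subset_range,
    card_twoPowSubset (freeColors_nonempty hdeg)]
  ring

theorem log_card_freeColors_le : Nat.log 2 #(freeColors H D γ v) ≤ Nat.clog 2 D :=
  (Nat.log_mono_right ((card_le_card (filter_subset _ _)).trans_eq (card_range D))).trans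
    (Nat.log_le_clog 2 D)

theorem eq_none_of_mem_candidates {c : ℕ} (hc : c ∈ candidates H D γ v) : γ v = none := by
  by_contra hv
  simp [candidates, hv] at hc

theorem ne_some_of_mem_candidates {c : ℕ} (hc : c ∈ candidates H D γ v) (hcD : c < D) {u : V}
    (hvu : H.Adj v u) : γ u ≠ some c := by
  rw [candidates, if_pos (eq_none_of_mem_candidates hc), pad, mem_union, mem_Ico] at hc
  have hfree := twoPowSubset_subset _ (hc.resolve_right (by omega))
  exact (mem_filter.1 hfree).2 u ((H.mem_neighborFinset _ _).2 hvu)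

theorem sum_overlap_candidates_le (hdeg : ∀ v, H.degree v < D) (hv : γ v = none) :
    ∑ u ∈ H.neighborFinset v,
      overlap (realColor D) (candidates H D γ v) (candidates H D γ u) ≤ 1 / 8 := by
  set B := twoPowSubset (freeColors H D γ v)
  have hB : (0 : ℝ) < #B := by
    rw [card_twoPowSubset (freeColors_nonempty (hdeg v))]
    positivity
  have hfew : #{u ∈ H.neighborFinset v | γ u = none} ≤ 2 * #B := by
    rw [card_twoPowSubset (freeColors_nonempty (hdeg v)), ← pow_succ']
    exact ((card_uncolored_neighbors_lt_card_freeColors (hdeg v)).trans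
      (Nat.lt_pow_succ_log_self one_lt_two _)).le
  calc ∑ u ∈ H.neighborFinset v, overlap (realColor D) (candidates H D γ v) (candidates H D γ u)
      ≤ ∑ u ∈ H.neighborFinset v, if γ u = none then 1 / 4 / (4 * #B : ℝ) else 0 := by
        refine sum_le_sum fun u _ => ?_
        split_ifs with hu
        · refine (overlap_le_expect_div_card (realColor_nonneg D) _ _).trans_eq ?_
          rw [candidates, candidates, if_pos hv, if_pos hu,
            card_pad twoPowSubset_freeColors_subset_range,
            expect_realColor_pad twoPowSubset_freeColors_subset_range
              (card_pos.1 (by rw [card_twoPowSubset (freeColors_nonempty (hdeg u))]; positivity))]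
          push_cast
          rfl
        · simp [overlap, candidates, hu]
    _ = #{u ∈ H.neighborFinset v | γ u = none} * (1 / 4 / (4 * #B : ℝ)) := by
        rw [← sum_filter, sum_const, nsmul_eq_mul]
    _ ≤ (2 * #B : ℕ) * (1 / 4 / (4 * #B : ℝ)) := by gcongr
    _ = 1 / 8 := by push_cast; field_simp; norm_num

theorem cost_candidates_le [Fintype V] (hdeg : ∀ v, H.degree v < D) :
    cost H 1 (realColor D) (dummyColor D) (candidates H D γ) ≤ 7 / 8 * #{v | γ v = none} := by
  rw [cost, mul_comm, ← nsmul_eq_mul, ← sum_const, sum_filter]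
  refine sum_le_sum fun v _ => ?_
  simp only [edgeCost, Pi.one_apply, one_mul]
  split_ifs with hv
  · have hsum := sum_overlap_candidates_le (γ := γ) hdeg hv
    have hdummy : 𝔼 c ∈ candidates H D γ v, dummyColor D c = 3 / 4 := by
      rw [candidates, if_pos hv]
      exact expect_dummyColor_pad twoPowSubset_freeColors_subset_range
        (card_pos.1 (by rw [card_twoPowSubset (freeColors_nonempty (hdeg v))]; positivity))
    linarith
  · simp [candidates, hv, overlap]

theorem adopt_eq_some {c : ℕ} (hc : adopt H D γ L v = some c) :
    γ v = some c ∨ c < D ∧ L v = {c} ∧ ∀ u, H.Adj v u → L u ≠ {c} := by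
  rw [adopt] at hc
  split_ifs at hc with h
  · obtain ⟨hcard, hD, hne⟩ := h
    obtain ⟨a, ha⟩ := card_eq_one.1 hcard
    simp only [ha, sup_singleton, id, Option.some.injEq, singleton_subset_iff, mem_range]
      at hc hD hne
    subst hc
    exact .inr ⟨hD, ha, fun u hu => hne u ((H.mem_neighborFinset _ _).2 hu)⟩
  · exact .inl hc

theorem adopt_eq_none (hv : adopt H D γ L v = none) :
    γ v = none ∧ ∀ c < D, L v = {c} → ∃ u ∈ H.neighborFinset v, L u = {c} := by
  rw [adopt] at hv
  split_ifs at hv with h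
  refine ⟨hv, fun c hc hLc => ?_⟩
  by_contra! hne
  exact h (by simpa [hLc, hc] using hne)

theorem IsPartialColoring.adopt (hγ : IsPartialColoring H D γ)
    (hL : ∀ v, L v ⊆ candidates H D γ v) : IsPartialColoring H D (adopt H D γ L) := by
  have mem_candidates {v c} (hLc : L v = {c}) : c ∈ candidates H D γ v :=
    hL v (hLc ▸ mem_singleton_self c)
  intro v c hv
  rcases adopt_eq_some hv with hv | ⟨hc, hLv, hne⟩
  · refine ⟨(hγ v c hv).1, fun u hvu hu => ?_⟩
    rcases adopt_eq_some hu with hu | ⟨hc, hLu, -⟩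
    · exact (hγ v c hv).2 u hvu hu
    · exact ne_some_of_mem_candidates (mem_candidates hLu) hc hvu.symm hv
  · refine ⟨hc, fun u hvu hu => ?_⟩
    rcases adopt_eq_some hu with hu | ⟨-, hLu, -⟩
    · exact ne_some_of_mem_candidates (mem_candidates hLv) hc hvu hu
    · exact hne u hvu hLu

/-- A vertex that stays uncoloured has drawn a dummy colour or is in conflict with a neighbour, so
it contributes at least one to the cost. -/
theorem card_uncolored_adopt_le_cost [Fintype V] (hL : ∀ v, γ v = none → #(L v) = 1) :
    (#{v | adopt H D γ L v = none} : ℝ) ≤ cost H 1 (realColor D) (dummyColor D) L := by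
  have hoverlap v u : 0 ≤ overlap (realColor D) (L v) (L u) :=
    overlap_nonneg (realColor_nonneg D) _ _
  have hdummy v : 0 ≤ 𝔼 c ∈ L v, dummyColor D c := expect_nonneg fun c _ => dummyColor_nonneg D c
  rw [← sum_boole, cost]
  refine sum_le_sum fun v _ => ?_
  simp only [edgeCost, Pi.one_apply, one_mul]
  split_ifs with hv
  · obtain ⟨hγv, hconflict⟩ := adopt_eq_none hv
    obtain ⟨c, hc⟩ := card_eq_one.1 (hL v hγv)
    rcases lt_or_ge c D with hcD | hcD
    · obtain ⟨u, hu, hLu⟩ := hconflict c hcD hc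
      have hone : overlap (realColor D) (L v) (L u) = 1 := by
        simp [hc, hLu, overlap, realColor, hcD]
      exact le_add_of_nonneg_of_le (hdummy v)
        (hone.symm.trans_le (single_le_sum (fun u _ => hoverlap v u) hu))
    · exact le_add_of_le_of_nonneg (by simp [hc, dummyColor, hcD])
        (sum_nonneg fun u _ => hoverlap v u)
  · exact add_nonneg (hdummy v) (sum_nonneg fun u _ => hoverlap v u)

variable [Fintype V] {cl : (V → V → ℝ) → V → ℕ} {K s : ℕ}

theorem IsPartialColoring.extendColoring {δ : ℝ} (hcl : IsAvgDefective H δ K cl)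
    (hγ : IsPartialColoring H D γ) : IsPartialColoring H D (extendColoring H D cl K s γ) :=
  hγ.adopt fun v => roundLists_subset hcl isWeight_one (realColor_nonneg D) s v

theorem card_uncolored_extendColoring_le (hs : Nat.clog 2 D + 2 ≤ s)
    (hcl : IsAvgDefective H (1 / (48 * s)) K cl) (hdeg : ∀ v, H.degree v < D) :
    (#{v | extendColoring H D cl K s γ v = none} : ℝ) ≤ 14 / 15 * #{v | γ v = none} := by
  calc (#{v | extendColoring H D cl K s γ v = none} : ℝ)
      ≤ cost H 1 (realColor D) (dummyColor D)
          (roundLists H cl K 1 (realColor D) (dummyColor D) (candidates H D γ) s) := by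
        refine card_uncolored_adopt_le_cost fun v hv => ?_
        rw [card_roundLists hcl isWeight_one (realColor_nonneg D) (card_candidates (hdeg v) hv)]
        have := log_card_freeColors_le (H := H) (D := D) (γ := γ) (v := v)
        rw [Nat.sub_eq_zero_of_le (by omega), pow_zero]
    _ ≤ 16 / 15 * cost H 1 (realColor D) (dummyColor D) (candidates H D γ) :=
        cost_roundLists_le_of_div (by omega) hcl isWeight_one (realColor_nonneg D)
          (dummyColor_nonneg D)
    _ ≤ 16 / 15 * (7 / 8 * #{v | γ v = none}) := by gcongr; exact cost_candidates_le hdeg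
    _ = 14 / 15 * #{v | γ v = none} := by ring

end Extension

section Coloring

/-- The number of sweeps that shrink every list of candidates to one colour. -/
def sweepCount (D : ℕ) : ℕ := Nat.clog 2 D + 2

/-- The logarithm of the number of classes that a sweep goes through. The factor `52` lets the
`2 ^ classLog D` classes have average defect at most `1 / (48 * sweepCount D)`. -/
def classLog (D : ℕ) : ℕ := Nat.clog 2 (52 * sweepCount D)

theorem classLog_pos (D : ℕ) : 0 < classLog D :=
  Nat.clog_pos one_lt_two (by rw [sweepCount]; omega)

variable {V : Type*} (H : SimpleGraph V) [H.LocallyFinite]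

/-- The classes that the sweeps go through, for identifiers below `2 ^ m`. -/
noncomputable def sweepClasses (D m : ℕ) (ident : V → ℕ) : (V → V → ℝ) → V → ℕ :=
  roundedClasses H
    (fineClasses H (classLog D) ((32 * D) ^ 4) (reduceColors H D m (2 ^ m) ident))
    (fineClassCount (classLog D) ((32 * D) ^ 4)) (classLog D)

/-- The partial colouring after `i` extension steps. -/
noncomputable def partialColoring (D m : ℕ) (ident : V → ℕ) : ℕ → V → Option ℕ
  | 0 => fun _ => none
  | i + 1 => extendColoring H D (sweepClasses H D m ident) (2 ^ classLog D) (sweepCount D)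
      (partialColoring D m ident i)

variable {H} {D m : ℕ} {ident : V → ℕ}

theorem card_le_of_injective_of_lt [Fintype V] {N : ℕ} (hinj : ident.Injective)
    (hident : ∀ v, ident v < N) : Fintype.card V ≤ N := by
  simpa using Fintype.card_le_of_injective (fun v => (⟨ident v, hident v⟩ : Fin N))
    fun u v h => hinj (by simpa using h)

variable (hdeg : ∀ v, H.degree v < D)
  (hinj : ident.Injective) (hident : ∀ v, ident v < 2 ^ m)
include hdeg hinj hident

theorem isAvgDefective_sweepClasses [Fintype V] [Nonempty V] :
    IsAvgDefective H (1 / (48 * sweepCount D)) (2 ^ classLog D) (sweepClasses H D m ident) := by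
  have hD : 0 < D := (Nat.zero_le _).trans_lt (hdeg (Classical.arbitrary V))
  obtain ⟨hlt, hne⟩ := reduceColors_spec hD hdeg le_rfl hident
    fun v u hvu h => hvu.ne' (hinj h)
  refine (isAvgDefective_roundedClasses (classLog_pos D)
    (isAvgDefective_fineClasses (classLog_pos D) hlt hne)).mono ?_
  have hpow : (52 * sweepCount D : ℝ) ≤ 2 ^ classLog D := by
    exact_mod_cast Nat.le_pow_clog one_lt_two (52 * sweepCount D)
  have hs : (0 : ℝ) < sweepCount D := by rw [sweepCount]; positivity
  rw [div_le_div_iff₀ (by positivity) (by positivity)]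
  linarith

theorem partialColoring_spec [Fintype V] [Nonempty V] (i : ℕ) :
    IsPartialColoring H D (partialColoring H D m ident i) ∧
      (#{v | partialColoring H D m ident i v = none} : ℝ) ≤ (14 / 15) ^ i * Fintype.card V := by
  have hcl := isAvgDefective_sweepClasses hdeg hinj hident
  induction i with
  | zero => exact ⟨fun v c hv => by simp [partialColoring] at hv, by simp [partialColoring]⟩
  | succ i ih =>
    refine ⟨ih.1.extendColoring hcl, ?_⟩
    have hstep := card_uncolored_extendColoring_le (γ := partialColoring H D m ident i) le_rfl
      hcl hdeg
    rw [pow_succ', mul_assoc]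
    exact hstep.trans (mul_le_mul_of_nonneg_left ih.2 (by norm_num))

theorem exists_coloring_partialColoring [Finite V] :
    ∃ κ : H.Coloring (Fin D), ∀ v, partialColoring H D m ident (11 * m + 1) v = some (κ v).val := by
  have := Fintype.ofFinite V
  rcases isEmpty_or_nonempty V with hV | hV
  · exact ⟨⟨fun v => hV.elim v, fun {v} => hV.elim v⟩, fun v => hV.elim v⟩
  obtain ⟨hproper, hcard⟩ := partialColoring_spec hdeg hinj hident (11 * m + 1)
  have hsmall : (14 / 15 : ℝ) ^ (11 * m + 1) * Fintype.card V < 1 := by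
    have hV : (Fintype.card V : ℝ) ≤ 2 ^ m := by
      exact_mod_cast card_le_of_injective_of_lt hinj hident
    calc (14 / 15 : ℝ) ^ (11 * m + 1) * Fintype.card V
        ≤ (14 / 15 : ℝ) ^ (11 * m + 1) * 2 ^ m := by gcongr
      _ = ((14 / 15 : ℝ) ^ 11 * 2) ^ m * (14 / 15) := by rw [pow_succ, pow_mul, mul_pow]; ring
      _ ≤ 1 * (14 / 15) := by gcongr; exact pow_le_one₀ (by positivity) (by norm_num)
      _ < 1 := by norm_num
  have hall v : ∃ c, partialColoring H D m ident (11 * m + 1) v = some c := by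
    rw [← Option.ne_none_iff_exists']
    have hempty := card_eq_zero.1 (Nat.lt_one_iff.1 (by exact_mod_cast hcard.trans_lt hsmall))
    exact filter_eq_empty_iff.1 hempty (mem_univ v)
  choose κ hκ using hall
  refine ⟨⟨fun v => ⟨κ v, (hproper v _ (hκ v)).1⟩, fun {v u} hvu h => ?_⟩, hκ⟩
  exact (hproper v _ (hκ v)).2 u hvu ((hκ u).trans (by rw [Fin.mk.inj h]))

end Coloring

section Locality

/-- A communication network, whose nodes carry identifiers. -/
structure Network where
  V : Type
  graph : SimpleGraph V
  [locallyFinite : graph.LocallyFinite]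
  ident : V → ℕ

attribute [instance] Network.locallyFinite

/-- All that a node can learn about the network in `t` rounds without using port numbers, encoded as
a natural number. -/
def Network.view (X : Network) : ℕ → X.V → ℕ
  | 0, v => X.ident v
  | t + 1, v =>
      Nat.pair (X.view t v) (Encodable.encode ((X.graph.neighborFinset v).val.map (X.view t)))

/-- The value of `Φ` at a node is determined by what the node can learn in `t` rounds. -/
def IsLocal {β : Type*} (t : ℕ) (Φ : ∀ X : Network, X.V → β) : Prop :=
  ∀ ⦃X Y : Network⦄ ⦃v : X.V⦄ ⦃v' : Y.V⦄, X.view t v = Y.view t v' → Φ X v = Φ Y v'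

/-- The value of `Φ` at a pair of nodes is determined by what these nodes can learn in `t`
rounds. -/
def IsEdgeLocal {β : Type*} (t : ℕ) (Φ : ∀ X : Network, X.V → X.V → β) : Prop :=
  ∀ ⦃X Y : Network⦄ ⦃v u : X.V⦄ ⦃v' u' : Y.V⦄, X.view t v = Y.view t v' → X.view t u = Y.view t u' →
    Φ X v u = Φ Y v' u'

/-- The rule `cl` computes local classes from local edge weights with `p` additional rounds,
provided that `t₀` rounds have already passed. -/
def IsLocalRule (t₀ p : ℕ) (cl : ∀ X : Network, (X.V → X.V → ℝ) → X.V → ℕ) : Prop :=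
  ∀ ⦃t : ℕ⦄, t₀ ≤ t → ∀ ⦃W : ∀ X : Network, X.V → X.V → ℝ⦄, IsEdgeLocal t W →
    IsLocal (t + p) fun X => cl X (W X)

variable {β : Type*} {t t' : ℕ}

theorem view_succ_eq_iff {X Y : Network} {v : X.V} {v' : Y.V} :
    X.view (t + 1) v = Y.view (t + 1) v' ↔ X.view t v = Y.view t v' ∧
      (X.graph.neighborFinset v).val.map (X.view t) =
        (Y.graph.neighborFinset v').val.map (Y.view t) := by
  simp only [Network.view, Nat.pair_eq_pair, Encodable.encode_inj]

theorem isLocal_view_of_le (h : t ≤ t') : IsLocal t' fun X => X.view t := by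
  induction h with
  | refl => exact fun _ _ _ _ h => h
  | step _ ih => exact fun _ _ _ _ h => ih (view_succ_eq_iff.1 h).1

theorem IsLocal.mono {Φ : ∀ X : Network, X.V → β} (hΦ : IsLocal t Φ) (h : t ≤ t') :
    IsLocal t' Φ :=
  fun _ _ _ _ hv => hΦ (isLocal_view_of_le h hv)

theorem IsEdgeLocal.mono {Φ : ∀ X : Network, X.V → X.V → β} (hΦ : IsEdgeLocal t Φ) (h : t ≤ t') :
    IsEdgeLocal t' Φ :=
  fun _ _ _ _ _ _ hv hu => hΦ (isLocal_view_of_le h hv) (isLocal_view_of_le h hu)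

theorem IsLocal.exists_eq_apply_view [Nonempty β] {Φ : ∀ X : Network, X.V → β}
    (hΦ : IsLocal t Φ) : ∃ f : ℕ → β, ∀ X v, Φ X v = f (X.view t v) := by
  have hfactors : Function.FactorsThrough (fun p : Σ X : Network, X.V => Φ p.1 p.2)
      fun p => p.1.view t p.2 := fun _ _ h => hΦ h
  obtain ⟨f, hf⟩ := (Function.factorsThrough_iff _).1 hfactors
  exact ⟨f, fun X v => congrFun hf ⟨X, v⟩⟩

theorem IsEdgeLocal.map_neighborFinset {Φ : ∀ X : Network, X.V → X.V → β}
    (hΦ : IsEdgeLocal t Φ) :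
    IsLocal (t + 1) fun X v => (X.graph.neighborFinset v).val.map (Φ X v) := by
  intro X Y v v' h
  obtain ⟨hv, hnbr⟩ := view_succ_eq_iff.1 h
  rw [← Multiset.rel_eq, Multiset.rel_map] at hnbr ⊢
  exact hnbr.mono fun u _ u' _ hu => hΦ hv hu

theorem IsEdgeLocal.sum_neighborFinset [AddCommMonoid β] {Φ : ∀ X : Network, X.V → X.V → β}
    (hΦ : IsEdgeLocal t Φ) : IsLocal (t + 1) fun X v => ∑ u ∈ X.graph.neighborFinset v, Φ X v u :=
  fun _ _ _ _ h => congrArg Multiset.sum (hΦ.map_neighborFinset h)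

theorem IsEdgeLocal.forall_neighborFinset {Φ : ∀ X : Network, X.V → X.V → Prop}
    (hΦ : IsEdgeLocal t Φ) :
    IsLocal (t + 1) fun X v => ∀ u ∈ X.graph.neighborFinset v, Φ X v u := by
  intro X Y v v' h
  have hforall := congrArg (fun s : Multiset Prop => ∀ P ∈ s, P) (hΦ.map_neighborFinset h)
  simpa only [Multiset.mem_map, forall_exists_index, and_imp, forall_apply_eq_imp_iff₂, mem_val]
    using hforall

section Rounding

variable {ι : Type*} [DecidableEq ι] {W : ∀ X : Network, X.V → X.V → ℝ} {μ h : ι → ℝ}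
  {κ : ∀ X : Network, X.V → ℕ} {L : ∀ X : Network, X.V → Finset ι}

theorem IsEdgeLocal.edgeCost (hW : IsEdgeLocal t W) (hL : IsLocal t L) :
    IsEdgeLocal t fun X => edgeCost (W X) μ (L X) :=
  fun _ _ _ _ _ _ hv hu => by simp only [LocalColoring.edgeCost, hW hv hu, hL hv, hL hu]

theorem IsEdgeLocal.crossWeight (hW : IsEdgeLocal t W) (hκ : IsLocal t κ) :
    IsEdgeLocal t fun X => crossWeight (κ X) (W X) :=
  fun _ _ _ _ _ _ hv hu => by simp only [LocalColoring.crossWeight, hW hv hu, hκ hv, hκ hu]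

theorem IsEdgeLocal.colorCost (hW : IsEdgeLocal t W) (hL : IsLocal t L) :
    IsLocal (t + 1) fun X => colorCost X.graph (W X) μ h (L X) := by
  intro X Y v v' hv
  ext c
  have hterm : IsEdgeLocal t fun X v u => W X v u * (if c ∈ L X u then μ c / #(L X u) else 0) :=
    fun _ _ _ _ _ _ hv hu => by simp only [hW hv hu, hL hu]
  exact congrArg (h c + 2 * ·) (hterm.sum_neighborFinset hv)

theorem IsEdgeLocal.sweep (hW : IsEdgeLocal t W) (hκ : IsLocal t κ) (hL : IsLocal t L) (j : ℕ) :
    IsLocal (t + j) fun X => sweep X.graph (W X) μ h (κ X) (L X) j := by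
  induction j with
  | zero => exact fun _ _ _ _ hv => hL hv
  | succ j ih =>
    intro X Y v v' hv
    have hcost := ((hW.crossWeight hκ).mono (t.le_add_right j)).colorCost (μ := μ) (h := h) ih hv
    simp only [LocalColoring.sweep, hcost, ih.mono (Nat.le_succ _) hv,
      hκ.mono (t.le_add_right (j + 1)) hv]

theorem IsLocalRule.roundLists {t₀ p K : ℕ} {cl : ∀ X : Network, (X.V → X.V → ℝ) → X.V → ℕ}
    (hcl : IsLocalRule t₀ p cl) (ht : t₀ ≤ t) (hW : IsEdgeLocal t W) (hL : IsLocal t L) (s : ℕ) :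
    IsLocal (t + s * (p + K)) fun X => roundLists X.graph (cl X) K (W X) μ h (L X) s := by
  induction s with
  | zero => exact hL.mono (by omega)
  | succ s ih =>
    have hW' := hW.mono (t' := t + s * (p + K)) (by omega)
    have hclass := hcl (by omega) (hW'.edgeCost (μ := μ) ih)
    refine ((hW'.mono (Nat.le_add_right _ p)).sweep hclass
      (ih.mono (Nat.le_add_right _ p)) K).mono (le_of_eq ?_)
    ring

end Rounding

section Classes

variable {W : ∀ X : Network, X.V → X.V → ℝ} {κ : ∀ X : Network, X.V → ℕ}

theorem IsEdgeLocal.agreement {q : ℕ} (hW : IsEdgeLocal t W) (hκ : IsLocal t κ) :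
    IsLocal (t + 1) fun X => agreement X.graph q (W X) (κ X) := by
  intro X Y v v' hv
  ext a
  have hterm : IsEdgeLocal t fun X v u =>
      if κ X u ≠ κ X v ∧ code q (κ X u) a = code q (κ X v) a then W X v u else 0 :=
    fun _ _ _ _ _ _ hv hu => by simp only [hW hv hu, hκ hv, hκ hu]
  simp only [LocalColoring.agreement, sum_filter]
  exact hterm.sum_neighborFinset hv

theorem IsEdgeLocal.defectColor {q : ℕ} (hW : IsEdgeLocal t W) (hκ : IsLocal t κ) :
    IsLocal (t + 1) fun X => defectColor X.graph q (W X) (κ X) :=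
  fun _ _ _ _ hv => by
    simp only [LocalColoring.defectColor, defectPoint, hW.agreement hκ hv,
      hκ.mono t.le_succ hv]

theorem isEdgeLocal_one : IsEdgeLocal t fun X => (1 : X.V → X.V → ℝ) := fun _ _ _ _ _ _ _ _ => rfl

theorem IsLocal.reduceColors (hκ : IsLocal t κ) (D m M : ℕ) :
    IsLocal (t + m) fun X => reduceColors X.graph D m M (κ X) := by
  induction m generalizing t M κ with
  | zero => exact hκ
  | succ m ih =>
    simp only [LocalColoring.reduceColors]
    split_ifs
    · exact hκ.mono (by omega)
    · exact (ih ((isEdgeLocal_one (t := t)).defectColor hκ) _).mono (by omega)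

theorem IsLocal.fineClasses (hκ : IsLocal t κ) (r M : ℕ) :
    IsLocalRule t 2 fun X => fineClasses X.graph r M (κ X) :=
  fun _ ht _ hW => (hW.mono (Nat.le_succ _)).defectColor (hW.defectColor (hκ.mono ht))

theorem IsLocalRule.roundedClasses {t₀ p : ℕ} {cl : ∀ X : Network, (X.V → X.V → ℝ) → X.V → ℕ}
    (hcl : IsLocalRule t₀ p cl) (K r : ℕ) :
    IsLocalRule t₀ (r * (p + K)) fun X => roundedClasses X.graph (cl X) K r :=
  fun _ ht _ hW _ _ _ _ hv => by
    simp only [LocalColoring.roundedClasses,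
      hcl.roundLists ht hW (L := fun _ _ => range (2 ^ r)) (fun _ _ _ _ _ => rfl) r hv]

end Classes

section Coloring

variable {γ : ∀ X : Network, X.V → Option ℕ}

theorem IsLocal.candidates (hγ : IsLocal t γ) (D : ℕ) :
    IsLocal (t + 1) fun X => candidates X.graph D (γ X) := by
  intro X Y v v' hv
  have hfree c : IsEdgeLocal t fun X _ u => γ X u ≠ some c :=
    fun _ _ _ _ _ _ _ hu => by simp only [hγ hu]
  simp only [LocalColoring.candidates, freeColors, hγ.mono t.le_succ hv,
    fun c => (hfree c).forall_neighborFinset hv]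

theorem IsLocal.adopt {L : ∀ X : Network, X.V → Finset ℕ} (hγ : IsLocal t γ) (hL : IsLocal t L)
    (D : ℕ) : IsLocal (t + 1) fun X => adopt X.graph D (γ X) (L X) := by
  intro X Y v v' hv
  have hne : IsEdgeLocal t fun X v u => L X u ≠ L X v :=
    fun _ _ _ _ _ _ hv hu => by simp only [hL hv, hL hu]
  have hforall := hne.forall_neighborFinset hv
  simp only [hL.mono t.le_succ hv] at hforall
  simp only [LocalColoring.adopt, hγ.mono t.le_succ hv, hL.mono t.le_succ hv, hforall]

theorem IsLocalRule.extendColoring {t₀ p K s : ℕ} {cl : ∀ X : Network, (X.V → X.V → ℝ) → X.V → ℕ}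
    (hcl : IsLocalRule t₀ p cl) (ht : t₀ ≤ t) (hγ : IsLocal t γ) (D : ℕ) :
    IsLocal (t + (s * (p + K) + 2)) fun X => extendColoring X.graph D (cl X) K s (γ X) :=
  have hlists := hcl.roundLists (K := K) (ht.trans t.le_succ) isEdgeLocal_one (hγ.candidates D) s
  ((hγ.mono (t' := t + 1 + s * (p + K)) (by omega)).adopt hlists D).mono (by omega)

/-- The number of rounds that one extension step takes. -/
noncomputable def extensionRounds (D : ℕ) : ℕ :=
  sweepCount D *
    (classLog D * (2 + fineClassCount (classLog D) ((32 * D) ^ 4)) + 2 ^ classLog D) + 2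

theorem isLocal_partialColoring (D m i : ℕ) :
    IsLocal (m + i * extensionRounds D) fun X => partialColoring X.graph D m X.ident i := by
  induction i with
  | zero => exact fun _ _ _ _ _ => rfl
  | succ i ih =>
    have hident : IsLocal 0 Network.ident := fun _ _ _ _ hv => hv
    have hbase := hident.reduceColors D m (2 ^ m)
    refine ((((hbase.fineClasses _ _).roundedClasses _ _).extendColoring ?_ ih D).mono ?_)
    · omega
    · rw [extensionRounds]
      exact le_of_eq (by ring)

end Coloring

end Locality

section Simulation

/-- The identifier of an edge, from the identifiers of its ends. -/
def edgeIdent {V : Type} (ident : V → ℕ) : Sym2 V → ℕ :=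
  Sym2.lift ⟨fun v u => Nat.pair (min (ident v) (ident u)) (max (ident v) (ident u)),
    fun _ _ => by simp only [min_comm, max_comm]⟩

theorem edgeIdent_injective {V : Type} {ident : V → ℕ} (hident : ident.Injective) :
    (edgeIdent ident).Injective := by
  intro e e' h
  induction e with | _ v u
  induction e' with | _ v' u'
  simp only [edgeIdent, Sym2.lift_mk, Nat.pair_eq_pair] at h
  rw [Sym2.eq_iff, ← hident.eq_iff, ← hident.eq_iff, ← hident.eq_iff (a := v),
    ← hident.eq_iff (a := u)]
  omega

theorem edgeIdent_lt {V : Type} {ident : V → ℕ} {N : ℕ} (h : ∀ v, ident v < N) (e : Sym2 V) :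
    edgeIdent ident e < N ^ 2 := by
  induction e with | _ v u
  exact (Nat.pair_lt_max_add_one_sq _ _).trans_le <|
    Nat.pow_le_pow_left (Nat.succ_le_of_lt (by simp [h v, h u])) 2

/-- The line graph of `G` as a network. -/
noncomputable abbrev lineNetwork {V : Type} [Finite V] (G : SimpleGraph V) (ident : V → ℕ) :
    Network where
  V := G.edgeSet
  graph := G.lineGraph
  locallyFinite _ := Fintype.ofFinite _
  ident e := edgeIdent ident e

section Ports

variable {V : Type} [Fintype V] {G : SimpleGraph V} [DecidableRel G.Adj]
  (port : LocalAlgorithm.PortNumbering G)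

/-- The edge at a port. -/
def edgeAt (v : V) (i : Fin (G.degree v)) : G.edgeSet := ⟨s(v, (port v i : V)), (port v i).2⟩

/-- The port at the other end of the edge. -/
def backPort (v : V) (i : Fin (G.degree v)) : Fin (G.degree (port v i)) :=
  (port (port v i)).symm ⟨v, (port v i).2.symm⟩

theorem edgeAt_injective (v : V) : (edgeAt port v).Injective := fun _ _ h =>
  (port v).injective <| Subtype.ext <| Sym2.congr_right.1 <| congrArg Subtype.val h

theorem mem_edgeAt (v : V) (i : Fin (G.degree v)) : v ∈ (edgeAt port v i : Sym2 V) :=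
  Sym2.mem_mk_left _ _

theorem exists_edgeAt_eq {v : V} {e : G.edgeSet} (h : v ∈ (e : Sym2 V)) :
    ∃ i, edgeAt port v i = e := by
  obtain ⟨e, he⟩ := e
  obtain ⟨w, rfl⟩ := Sym2.mem_iff_exists.1 h
  exact ⟨(port v).symm ⟨w, he⟩, Subtype.ext (by simp [edgeAt])⟩

theorem edgeAt_backPort (v : V) (i : Fin (G.degree v)) :
    edgeAt port (port v i) (backPort port v i) = edgeAt port v i :=
  Subtype.ext (by simp [edgeAt, backPort, Sym2.eq_swap])

theorem disjoint_edgeAt (v : V) (i : Fin (G.degree v)) :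
    Disjoint ((univ.erase i).map ⟨edgeAt port v, edgeAt_injective port v⟩)
      ((univ.erase (backPort port v i)).map
        ⟨edgeAt port (port v i), edgeAt_injective port (port v i)⟩) := by
  rw [disjoint_left]
  intro e he he'
  simp only [mem_map, mem_erase, mem_univ, and_true, Function.Embedding.coeFn_mk] at he he'
  obtain ⟨k, hk, rfl⟩ := he
  obtain ⟨l, -, hl⟩ := he'
  have hends : (edgeAt port v k : Sym2 V) = s(v, (port v i : V)) :=
    (Sym2.mem_and_mem_iff (port v i).2.ne).1
      ⟨mem_edgeAt port v k, hl ▸ mem_edgeAt port (port v i) l⟩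
  exact hk (edgeAt_injective port v (Subtype.ext hends))

variable [G.lineGraph.LocallyFinite]

theorem neighborFinset_edgeAt (v : V) (i : Fin (G.degree v)) :
    G.lineGraph.neighborFinset (edgeAt port v i) = disjUnion _ _ (disjoint_edgeAt port v i) := by
  ext e
  simp only [SimpleGraph.mem_neighborFinset, SimpleGraph.lineGraph_adj_iff_exists, mem_disjUnion,
    mem_map, mem_erase, mem_univ, and_true, Function.Embedding.coeFn_mk]
  constructor
  · rintro ⟨hne, w, hw, hwe⟩
    obtain ⟨l, rfl⟩ := exists_edgeAt_eq port hwe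
    rcases Sym2.mem_iff.1 hw with rfl | rfl
    · exact .inl ⟨l, fun h => hne (by rw [h]), rfl⟩
    · exact .inr ⟨l, fun h => hne (by rw [h, edgeAt_backPort]), rfl⟩
  · rintro (⟨l, hl, rfl⟩ | ⟨l, hl, rfl⟩)
    · exact ⟨fun h => hl (edgeAt_injective port v h.symm), v, mem_edgeAt port v i,
        mem_edgeAt port v l⟩
    · rw [← edgeAt_backPort]
      exact ⟨fun h => hl (edgeAt_injective port _ h.symm), _, mem_edgeAt port _ _,
        mem_edgeAt port _ l⟩

theorem degree_lineGraph_lt (hΔ : 0 < G.maxDegree) (e : G.edgeSet) :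
    G.lineGraph.degree e < 2 * G.maxDegree - 1 := by
  let port : LocalAlgorithm.PortNumbering G := fun v => Fintype.equivOfCardEq <|
    (Fintype.card_fin _).trans (G.card_neighborSet_eq_degree v).symm
  obtain ⟨v, hv⟩ : ∃ v, v ∈ (e : Sym2 V) := ⟨_, Sym2.out_fst_mem _⟩
  obtain ⟨i, rfl⟩ := exists_edgeAt_eq port hv
  rw [← SimpleGraph.card_neighborFinset_eq_degree, neighborFinset_edgeAt, card_disjUnion, card_map,
    card_map, card_erase_of_mem (mem_univ _), card_erase_of_mem (mem_univ _), card_univ, card_univ,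
    Fintype.card_fin, Fintype.card_fin]
  have := G.degree_le_maxDegree v
  have := G.degree_le_maxDegree (port v i)
  omega

end Ports

/-- State of a node that simulates the line graph: the global parameters, its identifier, and the
views of the edges at its ports, which are unknown before the first round. -/
structure SimulationState where
  n : ℕ
  Δ : ℕ
  ident : ℕ
  views : Option (ℕ → ℕ)

/-- The views of the edges at the ports other than `i`. -/
def otherViews (d : ℕ) (x : ℕ → ℕ) (i : Fin d) : Multiset ℕ :=
  (univ.erase i).val.map fun k : Fin d => x k

/-- The views at the ports of a node of degree `d`, from the identifiers of the neighbours in the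
first round, and from the views of the other edges at the neighbours in later rounds. -/
def updateViews (d : ℕ) (s : SimulationState) (msg : Fin d → ℕ × Multiset ℕ) (i : ℕ) : ℕ :=
  if h : i < d then
    match s.views with
    | none => Nat.pair (min s.ident (msg ⟨i, h⟩).1) (max s.ident (msg ⟨i, h⟩).1)
    | some x => Nat.pair (x i) (Encodable.encode (otherViews d x ⟨i, h⟩ + (msg ⟨i, h⟩).2))
  else 0

/-- The algorithm that collects the views of all edges in the line graph for `T n Δ` rounds, and
applies `f n Δ` to them. The additional round lets the nodes learn the identifiers of their
edges. -/
def simulation (T : ℕ → ℕ → ℕ) (f : ℕ → ℕ → ℕ → ℕ) : LocalAlgorithm where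
  State := SimulationState
  Msg := ℕ × Multiset ℕ
  rounds n Δ _ := T n Δ + 1
  init n Δ _ ident _ := ⟨n, Δ, ident, none⟩
  send d s i := (s.ident, otherViews d (s.views.getD 0) i)
  receive d s msg := { s with views := some (updateViews d s msg) }
  output _ s i := f s.n s.Δ (s.views.getD 0 i)

variable {V : Type} [Fintype V] {G : SimpleGraph V} [DecidableRel G.Adj]
  (port : LocalAlgorithm.PortNumbering G) (ident : V → ℕ)

/-- The views of the edges at the ports of `v` after `t` rounds of the line graph. -/
noncomputable def portViews (t : ℕ) (v : V) (i : ℕ) : ℕ :=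
  if h : i < G.degree v then (lineNetwork G ident).view t (edgeAt port v ⟨i, h⟩) else 0

theorem portViews_apply (t : ℕ) (v : V) (i : Fin (G.degree v)) :
    portViews port ident t v i = (lineNetwork G ident).view t (edgeAt port v i) :=
  dif_pos i.isLt

theorem view_succ_edgeAt (t : ℕ) (v : V) (i : Fin (G.degree v)) :
    (lineNetwork G ident).view (t + 1) (edgeAt port v i) =
      Nat.pair (portViews port ident t v i) (Encodable.encode
        (otherViews _ (portViews port ident t v) i +
          otherViews _ (portViews port ident t (port v i)) (backPort port v i))) := by
  let _ : G.lineGraph.LocallyFinite := (lineNetwork G ident).locallyFinite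
  simp only [otherViews, portViews_apply]
  refine congrArg (fun s : Multiset ℕ => Nat.pair _ (Encodable.encode s)) ?_
  change (G.lineGraph.neighborFinset (edgeAt port v i)).val.map _ = _
  rw [neighborFinset_edgeAt, disjUnion_val, Multiset.map_add, map_val, map_val, Multiset.map_map,
    Multiset.map_map]
  rfl

theorem stateAfter_simulation (T : ℕ → ℕ → ℕ) (f : ℕ → ℕ → ℕ → ℕ) (ε : ℝ) (t : ℕ) (v : V) :
    (simulation T f).stateAfter ident port ε (t + 1) v =
      ⟨Fintype.card V, G.maxDegree, ident v, some (portViews port ident t v)⟩ := by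
  induction t generalizing v with
  | zero =>
    refine congrArg (SimulationState.mk _ _ _ <| some ·) (funext fun i => ?_)
    simp only [portViews, updateViews]
    split_ifs <;> rfl
  | succ t ih =>
    rw [LocalAlgorithm.stateAfter]
    simp only [ih]
    refine congrArg (SimulationState.mk _ _ _ <| some ·) (funext fun i => ?_)
    by_cases h : i < G.degree v
    · rw [portViews_apply port ident (t + 1) v ⟨i, h⟩, view_succ_edgeAt]
      exact dif_pos h
    · rw [portViews, dif_neg h]
      exact dif_neg h

theorem finalOutput_simulation (T : ℕ → ℕ → ℕ) (f : ℕ → ℕ → ℕ → ℕ) (ε : ℝ) (v : V)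
    (i : Fin (G.degree v)) :
    (simulation T f).finalOutput ident port ε v i = f (Fintype.card V) G.maxDegree
      ((lineNetwork G ident).view (T (Fintype.card V) G.maxDegree) (edgeAt port v i)) := by
  have hstate := stateAfter_simulation port ident T f ε (T (Fintype.card V) G.maxDegree) v
  rw [LocalAlgorithm.finalOutput]
  change f (SimulationState.n _) (SimulationState.Δ _) _ = _
  rw [show (simulation T f).rounds (Fintype.card V) G.maxDegree ε =
    T (Fintype.card V) G.maxDegree + 1 from rfl, hstate]
  simp [portViews_apply]

end Simulation

section RoundCount

theorem classPrime_le {r M k : ℕ} (hr : 0 < r) (hk : 0 < k) (hM : M ≤ 2 ^ k) :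
    classPrime r M ≤ 194 * (r * k) := by
  have hclog : r * Nat.clog 2 M ≤ r * k := Nat.mul_le_mul_left r (Nat.clog_le_of_le_pow hM)
  have hpos : 0 < r * k := Nat.mul_pos hr hk
  have hprime := primeAbove_le (96 * r * Nat.clog 2 M)
  rw [mul_assoc 96] at hprime
  rw [classPrime, mul_assoc 96]
  omega

theorem fineClassCount_le {r M : ℕ} (hr : 0 < r) (hM : M ≤ 2 ^ 2 ^ r) :
    fineClassCount r M ≤ 2 ^ 24 * r ^ 4 := by
  have hfirst : classPrime r M ^ 2 ≤ 2 ^ (20 * r) := by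
    calc classPrime r M ^ 2 ≤ (194 * (r * 2 ^ r)) ^ 2 := by
          gcongr; exact classPrime_le hr (by positivity) hM
      _ ≤ (2 ^ 8 * (2 ^ r * 2 ^ r)) ^ 2 := by
          gcongr
          · norm_num
          · exact Nat.lt_two_pow_self.le
      _ = 2 ^ (16 + 4 * r) := by ring
      _ ≤ 2 ^ (20 * r) := Nat.pow_le_pow_right two_pos (by omega)
  calc fineClassCount r M ≤ (194 * (r * (20 * r))) ^ 2 := by
        rw [fineClassCount]; gcongr; exact classPrime_le hr (by omega) hfirst
    _ = 3880 ^ 2 * r ^ 4 := by ring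
    _ ≤ 2 ^ 24 * r ^ 4 := Nat.mul_le_mul_right _ (by norm_num)

theorem le_two_pow_two_pow_classLog (D : ℕ) : (32 * D) ^ 4 ≤ 2 ^ 2 ^ classLog D := by
  have hD : 32 * D ≤ 2 ^ (5 + Nat.clog 2 D) := by
    rw [pow_add]
    exact Nat.mul_le_mul_left _ (Nat.le_pow_clog one_lt_two D)
  have hexp : (5 + Nat.clog 2 D) * 4 ≤ 2 ^ classLog D :=
    le_trans (by rw [sweepCount]; omega) (Nat.le_pow_clog one_lt_two (52 * sweepCount D))
  calc (32 * D) ^ 4 ≤ (2 ^ (5 + Nat.clog 2 D)) ^ 4 := Nat.pow_le_pow_left hD 4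
    _ = 2 ^ ((5 + Nat.clog 2 D) * 4) := (pow_mul _ _ _).symm
    _ ≤ 2 ^ 2 ^ classLog D := Nat.pow_le_pow_right two_pos hexp

theorem two_pow_classLog_le (D : ℕ) : 2 ^ classLog D ≤ 104 * sweepCount D := by
  have hpow := two_pow_clog_le (M := 52 * sweepCount D) (by unfold sweepCount; omega)
  rw [classLog]
  omega

theorem extensionRounds_le_sweepCount (D : ℕ) :
    extensionRounds D ≤ 2 ^ 46 * sweepCount D ^ 2 := by
  have hcount := fineClassCount_le (classLog_pos D) (le_two_pow_two_pow_classLog D)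
  rw [extensionRounds]
  set r := classLog D
  set s := sweepCount D with hs
  have hs_pos : 0 < s := by rw [hs, sweepCount]; omega
  have hr₅ : r ^ 5 ≤ 3840 * 2 ^ r := pow_le_factorial_mul_two_pow 5 r
  have hr_le : r ≤ r ^ 5 := Nat.le_self_pow (by norm_num) r
  have hclasses : r * (2 + fineClassCount r ((32 * D) ^ 4)) ≤ 2 ^ 37 * 2 ^ r := by
    calc r * (2 + fineClassCount r ((32 * D) ^ 4)) ≤ r * (2 + 2 ^ 24 * r ^ 4) := by gcongr
      _ = 2 * r + 2 ^ 24 * r ^ 5 := by ring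
      _ ≤ 2 ^ 37 * 2 ^ r := by omega
  calc s * (r * (2 + fineClassCount r ((32 * D) ^ 4)) + 2 ^ r) + 2
      ≤ s * (2 ^ 37 * 2 ^ r + 2 ^ r) + 2 * s := by gcongr; omega
    _ = s * ((2 ^ 37 + 1) * 2 ^ r + 2) := by ring
    _ ≤ s * ((2 ^ 37 + 1) * (104 * s) + 2 * s) := by
        gcongr
        · exact two_pow_classLog_le D
        · omega
    _ = ((2 ^ 37 + 1) * 104 + 2) * s ^ 2 := by ring
    _ ≤ 2 ^ 46 * s ^ 2 := Nat.mul_le_mul_right _ (by norm_num)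

theorem extensionRounds_le {D : ℕ} (hD : 1 < D) :
    extensionRounds D ≤ 2 ^ 50 * Nat.clog 2 D ^ 2 := by
  have hclog : 0 < Nat.clog 2 D := Nat.clog_pos one_lt_two hD
  calc extensionRounds D ≤ 2 ^ 46 * sweepCount D ^ 2 := extensionRounds_le_sweepCount D
    _ ≤ 2 ^ 46 * (3 * Nat.clog 2 D) ^ 2 := by gcongr; rw [sweepCount]; omega
    _ = 2 ^ 46 * 9 * Nat.clog 2 D ^ 2 := by ring
    _ ≤ 2 ^ 50 * Nat.clog 2 D ^ 2 := Nat.mul_le_mul_right _ (by norm_num)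

/-- The number of bits of the identifiers that `edgeIdent` gives to the edges of a network with `n`
nodes, whose own identifiers are below `n ^ c`. -/
def identBits (c n : ℕ) : ℕ := 2 * c * Nat.clog 2 n

theorem pow_sq_le_two_pow_identBits (c n : ℕ) : (n ^ c) ^ 2 ≤ 2 ^ identBits c n := by
  rw [identBits, mul_comm, pow_mul, ← pow_mul, mul_comm c]
  exact Nat.pow_le_pow_left (Nat.le_pow_clog one_lt_two n) _

/-- The number of rounds in which the line graph of a network with `n` nodes and maximum degree `Δ`
gets coloured. -/
noncomputable def coloringRounds (c n Δ : ℕ) : ℕ :=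
  identBits c n + (11 * identBits c n + 1) * extensionRounds (2 * Δ - 1)

theorem coloringRounds_add_one_le (c n : ℕ) {Δ : ℕ} (hΔ : 2 ≤ Δ) :
    coloringRounds c n Δ + 1 ≤ 2 ^ 54 * Nat.clog 2 (2 * Δ - 1) ^ 2 * (identBits c n + 1) := by
  have hext := extensionRounds_le (D := 2 * Δ - 1) (by omega)
  have hclog : 0 < Nat.clog 2 (2 * Δ - 1) := Nat.clog_pos one_lt_two (by omega)
  rw [coloringRounds]
  set m := identBits c n
  set l := Nat.clog 2 (2 * Δ - 1)
  calc m + (11 * m + 1) * extensionRounds (2 * Δ - 1) + 1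
      ≤ (m + 1) * l ^ 2 + (11 * (m + 1)) * (2 ^ 50 * l ^ 2) := by
        have : m + 1 ≤ (m + 1) * l ^ 2 := Nat.le_mul_of_pos_right _ (by positivity)
        have : (11 * m + 1) * extensionRounds (2 * Δ - 1) ≤ 11 * (m + 1) * (2 ^ 50 * l ^ 2) :=
          Nat.mul_le_mul (by omega) hext
        omega
    _ = (11 * 2 ^ 50 + 1) * l ^ 2 * (m + 1) := by ring
    _ ≤ 2 ^ 54 * l ^ 2 * (m + 1) := by gcongr; norm_num

theorem logb_two_natCast_nonneg (n : ℕ) : 0 ≤ Real.logb 2 n :=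
  div_nonneg (Real.log_natCast_nonneg n) (Real.log_nonneg one_le_two)

theorem one_le_logb_two {n : ℕ} (hn : 2 ≤ n) : 1 ≤ Real.logb 2 n := by
  rw [Real.le_logb_iff_rpow_le one_lt_two (by positivity), Real.rpow_one]
  exact_mod_cast hn

theorem clog_two_le_two_mul_logb {n : ℕ} (hn : 2 ≤ n) :
    (Nat.clog 2 n : ℝ) ≤ 2 * Real.logb 2 n := by
  have hlog := one_le_logb_two hn
  rw [← Real.natCeil_logb_natCast 2 n, Nat.cast_ofNat]
  linarith [Nat.ceil_lt_add_one (zero_le_one.trans hlog)]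

theorem coloringRounds_add_one_le_logb (c : ℕ) {n Δ : ℕ} (hn : 2 ≤ n) (hΔ : 2 ≤ Δ) :
    (coloringRounds c n Δ + 1 : ℝ) ≤
      2 ^ 58 * (4 * c + 1) * (Real.logb 2 Δ ^ 2 * Real.logb 2 n) := by
  have hlogn := one_le_logb_two hn
  have hdeg : (Nat.clog 2 (2 * Δ - 1) : ℝ) ≤ 4 * Real.logb 2 Δ := by
    have hmono : (Nat.clog 2 (2 * Δ - 1) : ℝ) ≤ Nat.clog 2 (2 * Δ) := by
      exact_mod_cast Nat.clog_mono_right 2 (Nat.sub_le _ _)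
    have hdouble : Real.logb 2 (2 * Δ : ℕ) = 1 + Real.logb 2 Δ := by
      push_cast
      rw [Real.logb_mul two_ne_zero (by positivity), Real.logb_self_eq_one one_lt_two]
    linarith [clog_two_le_two_mul_logb (n := 2 * Δ) (by omega), one_le_logb_two hΔ]
  have hbits : (identBits c n + 1 : ℝ) ≤ (4 * c + 1) * Real.logb 2 n := by
    rw [identBits]
    push_cast
    have hc : (0 : ℝ) ≤ 2 * c := by positivity
    linarith [mul_le_mul_of_nonneg_left (clog_two_le_two_mul_logb hn) hc]
  calc (coloringRounds c n Δ + 1 : ℝ)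
      ≤ 2 ^ 54 * (Nat.clog 2 (2 * Δ - 1) : ℝ) ^ 2 * (identBits c n + 1) := by
        exact_mod_cast coloringRounds_add_one_le c n hΔ
    _ ≤ 2 ^ 54 * (4 * Real.logb 2 Δ) ^ 2 * ((4 * c + 1) * Real.logb 2 n) := by gcongr
    _ = 2 ^ 58 * (4 * c + 1) * (Real.logb 2 Δ ^ 2 * Real.logb 2 n) := by ring

end RoundCount

theorem computesEdgeColoring_mono {V : Type} [Fintype V] {G : SimpleGraph V} [DecidableRel G.Adj]
    {A : LocalAlgorithm} {ident : V → ℕ} {port : LocalAlgorithm.PortNumbering G} {ε : ℝ} {k k' : ℕ}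
    (hk : k ≤ k') (h : A.ComputesEdgeColoring ident port ε k) :
    A.ComputesEdgeColoring ident port ε k' := by
  obtain ⟨κ, hκ⟩ := h
  exact ⟨(SimpleGraph.Embedding.completeGraph (Fin.castLEEmb hk)).toHom.comp κ, hκ⟩

theorem two_mul_sub_one_le_floor {ε : ℝ} (hε : 0 ≤ ε) (Δ : ℕ) :
    2 * Δ - 1 ≤ ⌊(2 + ε) * (Δ : ℝ)⌋₊ := by
  refine (Nat.sub_le _ _).trans (Nat.le_floor ?_)
  push_cast
  gcongr
  linarith

theorem mul_le_mul_max_one {a b : ℝ} (ha : 0 ≤ a) (hb : 0 ≤ b) (x y z : ℝ) {p : ℝ} (hp : 0 ≤ p) :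
    a * b ≤ a * max 1 x * max 1 y * max 1 z ^ p * b := by
  have hfactors : 1 ≤ max 1 x * max 1 y * max 1 z ^ p :=
    one_le_mul_of_one_le_of_one_le
      (one_le_mul_of_one_le_of_one_le (le_max_left _ _) (le_max_left _ _))
      (Real.one_le_rpow (le_max_left _ _) hp)
  rw [mul_assoc a, mul_assoc a]
  exact mul_le_mul_of_nonneg_right (le_mul_of_one_le_right ha hfactors) hb

theorem one_lt_card_of_maxDegree_pos {V : Type*} [Fintype V] {G : SimpleGraph V}
    [DecidableRel G.Adj] (hΔ : 0 < G.maxDegree) : 1 < Fintype.card V := by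
  rw [Fintype.one_lt_card_iff_nontrivial, ← not_subsingleton_iff_nontrivial]
  exact fun _ => hΔ.ne' G.maxDegree_of_subsingleton

end LocalColoring

open LocalColoring in
theorem corollary2_general (c : ℕ) :
    ∃ C : ℝ, 0 < C ∧ ∃ A : LocalAlgorithm,
      ∀ (V : Type) [Fintype V] (G : SimpleGraph V) [DecidableRel G.Adj]
        (ident : V → ℕ) (port : LocalAlgorithm.PortNumbering G) (ε : ℝ),
        Function.Injective ident →
        (∀ v, ident v < Fintype.card V ^ c) →
        2 ≤ G.maxDegree →
        A.ComputesEdgeColoring ident port ε (2 * G.maxDegree - 1) ∧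
        (A.rounds (Fintype.card V) G.maxDegree ε : ℝ) ≤
          C * ((Real.logb 2 G.maxDegree) ^ 2 * Real.logb 2 (Fintype.card V)) := by
  have hlocal n Δ : IsLocal (coloringRounds c n Δ) fun X =>
      partialColoring X.graph (2 * Δ - 1) (identBits c n) X.ident (11 * identBits c n + 1) :=
    isLocal_partialColoring _ _ _
  choose f hf using fun n Δ => (hlocal n Δ).exists_eq_apply_view
  refine ⟨2 ^ 58 * (4 * c + 1), by positivity,
    simulation (coloringRounds c) fun n Δ x => (f n Δ x).getD 0,
    fun V _ G _ ident port ε hinj hlt hΔ => ⟨?_, ?_⟩⟩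
  · let _ : G.lineGraph.LocallyFinite := (lineNetwork G ident).locallyFinite
    obtain ⟨κ, hκ⟩ := exists_coloring_partialColoring
      (degree_lineGraph_lt (G := G) (zero_lt_two.trans_le hΔ))
      ((edgeIdent_injective hinj).comp Subtype.val_injective)
      fun e => (edgeIdent_lt hlt e).trans_le (pow_sq_le_two_pow_identBits c (Fintype.card V))
    refine ⟨κ, fun v i => ?_⟩
    rw [finalOutput_simulation, ← hf]
    exact congrArg (Option.getD · 0) (hκ (edgeAt port v i))
  · have hrounds := coloringRounds_add_one_le_logb c
      (one_lt_card_of_maxDegree_pos (zero_lt_two.trans_le hΔ)) hΔ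
    exact_mod_cast hrounds

open LocalColoring in
/-- `(2 + ε)Δ`-edge colouring in the deterministic `LOCAL` model; `n ^ c` bounds the identifiers,
logarithms are to base two. -/
theorem corollary2 (c : ℕ) :
    ∃ C : ℝ, 0 < C ∧ ∃ A : LocalAlgorithm,
      ∀ (V : Type) [Fintype V] (G : SimpleGraph V) [DecidableRel G.Adj]
        (ident : V → ℕ) (port : LocalAlgorithm.PortNumbering G) (ε : ℝ),
        Function.Injective ident →
        (∀ v, ident v < Fintype.card V ^ c) →
        2 ≤ G.maxDegree →
        1 / Real.logb 2 G.maxDegree < ε →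
        A.ComputesEdgeColoring ident port ε ⌊(2 + ε) * (G.maxDegree : ℝ)⌋₊ ∧
        (A.rounds (Fintype.card V) G.maxDegree ε : ℝ) ≤
          C * ((Real.logb 2 G.maxDegree) ^ 2 * max 1 ε⁻¹
            * max 1 (Real.logb 2 (Real.logb 2 G.maxDegree))
            * (max 1 (Real.logb 2 (Real.logb 2 (Real.logb 2 G.maxDegree)))) ^ (1.71 : ℝ)
            * Real.logb 2 (Fintype.card V)) := by
  obtain ⟨C, hC, A, hA⟩ := corollary2_general c
  exact ⟨C, hC, A, fun V _ G _ ident port ε hinj hlt hΔ hε =>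
    (hA V G ident port ε hinj hlt hΔ).imp
      (computesEdgeColoring_mono
        (two_mul_sub_one_le_floor ((one_div_nonneg.2 (logb_two_natCast_nonneg _)).trans hε.le) _))
      (·.trans (mul_le_mul_of_nonneg_left (mul_le_mul_max_one (sq_nonneg _)
        (logb_two_natCast_nonneg _) _ _ _ (by norm_num)) hC.le))⟩
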